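/- Let $n,r\ge 1$ and let $S\in\{\pm1\}^{n\times r}$ be a sign matrix whose permeance $$\nu(S)=\tfrac1n\,\lambda_{\min}(S^{\mathsf t}S)=\tfrac1n\min_{\|u\|_{\ell_2}=1}\|Su\|_{\ell_2}^2$$ is positive, and let $m\ge r$ be a natural number. Let $L_0\in\mathbb R^{n\times m}$ be drawn from the Gaussian loadings model $\mathrm{GLM}(S,m)$, that is, $L_0$ has the law of $r^{-1/2}SG^{\mathsf t}$, where $G\in\mathbb R^{m\times r}$ is a standard normal matrix (independent $N(0,1)$ entries). For a matrix $L\in\mathbb R^{n\times m}$ of rank $\rho\geq 1$ with (compact) singular value decomposition $L=U\Sigma V^{\mathsf t}$, $U\in\mathbb R^{n\times \rho}$, $V\in\mathbb R^{m\times \rho}$, put $$\mu_{(l)}(L)=\tfrac n\rho\max_{k\le n}\|P_{\mathrm{ran}(L)}e_k\|_{\ell_2}^2,\qquad \mu_{(r)}(L)=\tfrac m\rho\max_{l\le m}\|P_{\mathrm{ran}(L^{\mathsf t})}e_l\|_{\ell_2}^2,\qquad \tilde\mu(L)=\tfrac{nm}\rho\max_{k\le n,\,l\le m}|\langle e_k,UV^{\mathsf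 t}e_l\rangle|^2,$$ where $P$ denotes the orthogonal projector onto the indicated subspace ($UV^{\mathsf t}$ does not depend on the choice of the decomposition). Then $L_0$ has rank $r$ almost surely. The bound $$\mu_{(l)}(L_0)\le\nu(S)^{-1}$$ holds almost surely; more precisely, it holds deterministically for $L_0=r^{-1/2}SG^{\mathsf t}$ whenever $G\in\mathbb R^{m\times r}$ has rank $r$. Moreover, for every $\alpha>0$, $$\Pr\bigl[\mu_{(r)}(L_0)\ge 4(\alpha+1)\log(n+m)\bigr]\le \frac{2(nm)^{-\alpha}}{n},\qquad \Pr\Bigl[\tilde\mu(L_0)\ge \tfrac{4(\alpha+1)}{\nu(S)}\log(n+m)\Bigr]\le 2(nm)^{-\alpha},$$ where $\log$ is the natural logarithm. -/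

import Mathlib

open MeasureTheory ProbabilityTheory Matrix
open scoped ENNReal

namespace GaussianLoadings

noncomputable section

/-- The Borel (product) σ-algebra on real matrices. -/
instance instMeasurableSpaceRealMatrix (n m : ℕ) :
    MeasurableSpace (Matrix (Fin n) (Fin m) ℝ) :=
  inferInstanceAs (MeasurableSpace (Fin n → Fin m → ℝ))

/-- A sign matrix: every entry is `1` or `-1`. -/
def IsSignMatrix {n r : ℕ} (S : Matrix (Fin n) (Fin r) ℝ) : Prop :=
  ∀ i j, S i j = 1 ∨ S i j = -1

/-- The permeance statistic `ν(S) = (1/n) min_{‖u‖ = 1} ‖S u‖²` (Euclidean norms); equivalently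
`1/n` times the smallest eigenvalue of `Sᵀ S`.  For `n = 0` or `r = 0` its value is `0`. -/
def permeance {n r : ℕ} (S : Matrix (Fin n) (Fin r) ℝ) : ℝ :=
  (1 / (n : ℝ)) *
    ⨅ u : Metric.sphere (0 : EuclideanSpace ℝ (Fin r)) 1, ‖Matrix.toEuclideanLin S u‖ ^ 2

/-- The law of the `m × r` standard normal matrix: independent `N(0,1)` entries. -/
def stdNormalMatrix (m r : ℕ) : Measure (Matrix (Fin m) (Fin r) ℝ) :=
  Measure.pi fun _ : Fin m => Measure.pi fun _ : Fin r => gaussianReal 0 1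

/-- The matrix `r^{-1/2} S Gᵀ`. -/
def loadingsMatrix {n r m : ℕ} (S : Matrix (Fin n) (Fin r) ℝ) (G : Matrix (Fin m) (Fin r) ℝ) :
    Matrix (Fin n) (Fin m) ℝ :=
  (1 / √(r : ℝ)) • (S * Gᵀ)

theorem measurable_loadingsMatrix {n r m : ℕ} (S : Matrix (Fin n) (Fin r) ℝ) :
    Measurable (loadingsMatrix (m := m) S) := by
  refine measurable_pi_lambda _ fun i => measurable_pi_lambda _ fun j => ?_
  simp only [loadingsMatrix, Matrix.smul_apply, Matrix.mul_apply, Matrix.transpose_apply,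
    smul_eq_mul]
  exact (Finset.measurable_sum _ fun k _ => ((measurable_pi_apply k).comp
    (measurable_pi_apply (X := fun _ : Fin m => Fin r → ℝ) j)).const_mul _).const_mul _

/-- The Gaussian loadings model `GLM(S, m)`: the law of `r^{-1/2} S Gᵀ` where `G` is an `m × r`
standard normal matrix. -/
def GLM {n r : ℕ} (S : Matrix (Fin n) (Fin r) ℝ) (m : ℕ) : Measure (Matrix (Fin n) (Fin m) ℝ) :=
  (stdNormalMatrix m r).map (loadingsMatrix S)

instance isProbabilityMeasure_GLM {n r : ℕ} (S : Matrix (Fin n) (Fin r) ℝ) (m : ℕ) :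
    IsProbabilityMeasure (GLM S m) := by
  have : IsProbabilityMeasure (stdNormalMatrix m r) := by
    unfold stdNormalMatrix
    exact inferInstanceAs (IsProbabilityMeasure
      (Measure.pi fun _ : Fin m => Measure.pi fun _ : Fin r => gaussianReal 0 1))
  exact Measure.isProbabilityMeasure_map (measurable_loadingsMatrix S).aemeasurable

/-- The range (column space) of a matrix, as a subspace of Euclidean space. -/
def ran {n m : ℕ} (L : Matrix (Fin n) (Fin m) ℝ) : Submodule ℝ (EuclideanSpace ℝ (Fin n)) :=
  LinearMap.range (Matrix.toEuclideanLin L)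

/-- Left incoherence `(n / rank L) max_k ‖P_{ran L} e_k‖²`. -/
def leftIncoherence {n m : ℕ} (L : Matrix (Fin n) (Fin m) ℝ) : ℝ :=
  ((n : ℝ) / (L.rank : ℝ)) *
    ⨆ k : Fin n, ‖(ran L).starProjection (EuclideanSpace.single k (1 : ℝ))‖ ^ 2

/-- Right incoherence `(m / rank L) max_l ‖P_{ran Lᵀ} e_l‖²`. -/
def rightIncoherence {n m : ℕ} (L : Matrix (Fin n) (Fin m) ℝ) : ℝ :=
  ((m : ℝ) / (L.rank : ℝ)) *
    ⨆ l : Fin m, ‖(ran Lᵀ).starProjection (EuclideanSpace.single l (1 : ℝ))‖ ^ 2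

/-- `L = U diag(σ) Vᵀ` is a compact singular value decomposition: `U`, `V` have `rank L`
orthonormal columns and all the `σ i` are positive.  (No order is imposed on the `σ i`: permuting
them together with the columns of `U` and `V` does not change `U Vᵀ`.) -/
structure IsSVD {n m : ℕ} (L : Matrix (Fin n) (Fin m) ℝ) (U : Matrix (Fin n) (Fin L.rank) ℝ)
    (σ : Fin L.rank → ℝ) (V : Matrix (Fin m) (Fin L.rank) ℝ) : Prop where
  left_orthonormal : Uᵀ * U = 1
  right_orthonormal : Vᵀ * V = 1
  pos : ∀ i, 0 < σ i
  eq : L = U * Matrix.diagonal σ * Vᵀ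

theorem exists_isSVD {n m : ℕ} (L : Matrix (Fin n) (Fin m) ℝ) :
    ∃ U σ V, IsSVD L U σ V := by
  have hA : (Lᵀ * L).IsHermitian := by
    simpa using Matrix.isHermitian_conjTranspose_mul_self L
  have hpsd : (Lᵀ * L).PosSemidef := by
    simpa using Matrix.posSemidef_conjTranspose_mul_self L
  have hcard : Fintype.card {i // hA.eigenvalues i ≠ 0} = Fintype.card (Fin L.rank) := by
    rw [← hA.rank_eq_card_non_zero_eigs, Matrix.rank_transpose_mul_self, Fintype.card_fin]
  let e : Fin L.rank ≃ {i // hA.eigenvalues i ≠ 0} := (Fintype.equivOfCardEq hcard).symm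
  let Q : Matrix (Fin m) (Fin m) ℝ := hA.eigenvectorUnitary
  have hQ1 : Qᵀ * Q = 1 := by
    simpa [Q, Matrix.star_eq_conjTranspose] using Unitary.coe_star_mul_self hA.eigenvectorUnitary
  have hQ2 : Q * Qᵀ = 1 := by
    simpa [Q, Matrix.star_eq_conjTranspose] using Unitary.coe_mul_star_self hA.eigenvectorUnitary
  have hspec : Qᵀ * (Lᵀ * L) * Q = Matrix.diagonal hA.eigenvalues := by
    have h2 : Lᵀ * L = Q * Matrix.diagonal hA.eigenvalues * Qᵀ := by
      simpa [Q, Unitary.conjStarAlgAut_apply, Matrix.star_eq_conjTranspose, Function.comp_def]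
        using hA.spectral_theorem
    calc Qᵀ * (Lᵀ * L) * Q = Qᵀ * (Q * Matrix.diagonal hA.eigenvalues * Qᵀ) * Q :=
          congrArg (fun X => Qᵀ * X * Q) h2
      _ = (Qᵀ * Q) * Matrix.diagonal hA.eigenvalues * (Qᵀ * Q) := by
          simp only [Matrix.mul_assoc]
      _ = _ := by rw [hQ1]; simp
  have hent : ∀ i j, ((L * Q)ᵀ * (L * Q)) i j = Matrix.diagonal hA.eigenvalues i j := by
    intro i j
    rw [← hspec, Matrix.transpose_mul]
    simp only [Matrix.mul_assoc]
  have hpos : ∀ i, 0 < hA.eigenvalues (e i) := fun i =>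
    lt_of_le_of_ne (hpsd.eigenvalues_nonneg _) (Ne.symm (e i).2)
  let σ : Fin L.rank → ℝ := fun i => √(hA.eigenvalues (e i))
  have hσ : ∀ i, 0 < σ i := fun i => Real.sqrt_pos.2 (hpos i)
  have hσ2 : ∀ i, σ i * σ i = hA.eigenvalues (e i) := fun i => Real.mul_self_sqrt (hpos i).le
  refine ⟨Matrix.of fun a i => (L * Q) a (e i) / σ i, σ, Matrix.of fun a i => Q a (e i),
    ?_, ?_, hσ, ?_⟩
  · ext i j
    have h := hent (e i) (e j)
    simp only [Matrix.mul_apply (M := (L * Q)ᵀ), Matrix.transpose_apply] at h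
    simp only [Matrix.mul_apply (N := Matrix.of fun a i => (L * Q) a (e i) / σ i),
      Matrix.transpose_apply, Matrix.of_apply, div_mul_div_comm]
    rw [← Finset.sum_div, h]
    by_cases hij : i = j
    · subst hij
      rw [Matrix.diagonal_apply_eq, hσ2, Matrix.one_apply_eq, div_self (hpos i).ne']
    · have : (e i : Fin m) ≠ e j := fun h => hij (e.injective (Subtype.ext h))
      rw [Matrix.diagonal_apply_ne _ this, Matrix.one_apply_ne hij, zero_div]
  · ext i j
    have h : (Qᵀ * Q) (e i) (e j) = (1 : Matrix (Fin m) (Fin m) ℝ) (e i) (e j) := by rw [hQ1]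
    rw [Matrix.mul_apply] at h ⊢
    simp only [Matrix.transpose_apply, Matrix.of_apply] at h ⊢
    rw [h]
    by_cases hij : i = j
    · subst hij; simp
    · have : (e i : Fin m) ≠ e j := fun h => hij (e.injective (Subtype.ext h))
      rw [Matrix.one_apply_ne this, Matrix.one_apply_ne hij]
  · have hz : ∀ a i, hA.eigenvalues i = 0 → (L * Q) a i = 0 := by
      intro a i hi
      have h := hent i i
      rw [Matrix.diagonal_apply_eq, hi, Matrix.mul_apply] at h
      simp only [Matrix.transpose_apply] at h
      have := (Finset.sum_eq_zero_iff_of_nonneg (fun a _ => mul_self_nonneg _)).1 h a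
        (Finset.mem_univ a)
      exact mul_self_eq_zero.1 this
    ext a b
    have h1 : L a b = ∑ i, (L * Q) a i * Q b i := by
      have : L = (L * Q) * Qᵀ := by rw [Matrix.mul_assoc, hQ2, Matrix.mul_one]
      conv_lhs => rw [this, Matrix.mul_apply]
      rfl
    have h2 : ∑ i, (L * Q) a i * Q b i
        = ∑ i : {i // hA.eigenvalues i ≠ 0}, (L * Q) a i * Q b i := by
      rw [← Finset.sum_subtype (Finset.univ.filter fun i => hA.eigenvalues i ≠ 0) (by simp)
        (fun i => (L * Q) a i * Q b i), Finset.sum_filter_of_ne]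
      intro i _ hne h0
      exact hne (by rw [hz a i h0, zero_mul])
    rw [h1, h2, ← e.sum_comp, Matrix.mul_apply]
    refine Finset.sum_congr rfl fun i _ => ?_
    rw [Matrix.mul_diagonal]
    simp only [Matrix.transpose_apply, Matrix.of_apply]
    rw [div_mul_cancel₀ _ (hσ i).ne']

open scoped MatrixOrder Matrix.Norms.L2Operator in
/-- The product `U Vᵀ` does not depend on the singular value decomposition. -/
theorem IsSVD.mul_transpose_unique {n m : ℕ} {L : Matrix (Fin n) (Fin m) ℝ}
    {U U' : Matrix (Fin n) (Fin L.rank) ℝ} {σ σ' : Fin L.rank → ℝ}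
    {V V' : Matrix (Fin m) (Fin L.rank) ℝ} (h : IsSVD L U σ V) (h' : IsSVD L U' σ' V') :
    U * Vᵀ = U' * V'ᵀ := by
  -- the absolute value `H = V Σ Vᵀ` of `L` and its pseudo-inverse `K`
  have key : ∀ {U : Matrix (Fin n) (Fin L.rank) ℝ} {σ : Fin L.rank → ℝ}
      {V : Matrix (Fin m) (Fin L.rank) ℝ}, IsSVD L U σ V →
      (V * diagonal σ * Vᵀ).PosSemidef ∧ (V * diagonal σ * Vᵀ) ^ 2 = Lᵀ * L ∧
      L = U * Vᵀ * (V * diagonal σ * Vᵀ) ∧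
      V * Vᵀ * (V * diagonal σ * Vᵀ) = V * diagonal σ * Vᵀ ∧
      (V * diagonal σ * Vᵀ) * (V * diagonal (fun i => (σ i)⁻¹) * Vᵀ) = V * Vᵀ ∧
      U * Vᵀ * (V * Vᵀ) = U * Vᵀ := by
    intro U σ V h
    have hV : ∀ {k : ℕ} (X : Matrix (Fin L.rank) (Fin k) ℝ), Vᵀ * (V * X) = X := by
      intro k X; rw [← Matrix.mul_assoc, h.right_orthonormal, Matrix.one_mul]
    have hU : ∀ {k : ℕ} (X : Matrix (Fin L.rank) (Fin k) ℝ), Uᵀ * (U * X) = X := by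
      intro k X; rw [← Matrix.mul_assoc, h.left_orthonormal, Matrix.one_mul]
    refine ⟨?_, ?_, ?_, ?_, ?_, ?_⟩
    · have := (Matrix.PosSemidef.diagonal (fun i => (h.pos i).le)).mul_mul_conjTranspose_same V
      simpa using this
    · have e1 : Lᵀ * L = (U * diagonal σ * Vᵀ)ᵀ * (U * diagonal σ * Vᵀ) :=
        congrArg (fun X => Xᵀ * X) h.eq
      rw [e1, pow_two]
      simp only [Matrix.transpose_mul, Matrix.transpose_transpose, Matrix.diagonal_transpose,
        Matrix.mul_assoc, hV, hU]
    · simp only [Matrix.mul_assoc, hV]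
      simpa only [Matrix.mul_assoc] using h.eq
    · simp only [Matrix.mul_assoc, hV]
    · have e2 : diagonal σ * diagonal (fun i => (σ i)⁻¹) = 1 := by
        rw [Matrix.diagonal_mul_diagonal]
        simp [(h.pos _).ne']
      simp only [Matrix.mul_assoc, hV]
      rw [← Matrix.mul_assoc (diagonal σ), e2, Matrix.one_mul]
    · simp only [Matrix.mul_assoc, hV]
  obtain ⟨a1, a2, a3, a4, a5, a6⟩ := key h
  obtain ⟨b1, b2, b3, b4, b5, b6⟩ := key h'
  have hH : V * diagonal σ * Vᵀ = V' * diagonal σ' * V'ᵀ := by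
    have e1 := CFC.sqrt_unique (a := Lᵀ * L) (b := V * diagonal σ * Vᵀ)
      (by rw [← a2, pow_two]) a1.nonneg
    have e2 := CFC.sqrt_unique (a := Lᵀ * L) (b := V' * diagonal σ' * V'ᵀ)
      (by rw [← b2, pow_two]) b1.nonneg
    rw [← e1, ← e2]
  rw [← hH] at b3 b4 b5
  have p1 : V' * V'ᵀ * (V * Vᵀ) = V * Vᵀ := by
    rw [← a5, ← Matrix.mul_assoc, b4]
  have p2 : V * Vᵀ * (V' * V'ᵀ) = V' * V'ᵀ := by
    rw [← b5, ← Matrix.mul_assoc, a4]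
  have p3 : V * Vᵀ = V' * V'ᵀ := by
    have := congrArg Matrix.transpose p1
    simp only [Matrix.transpose_mul, Matrix.transpose_transpose] at this
    rw [← this, p2]
  have q : U * Vᵀ * (V * diagonal σ * Vᵀ) = U' * V'ᵀ * (V * diagonal σ * Vᵀ) := a3.symm.trans b3
  have q2 := congrArg (fun X => X * (V * diagonal (fun i => (σ i)⁻¹) * Vᵀ)) q
  simp only [Matrix.mul_assoc _ (V * diagonal σ * Vᵀ), a5] at q2
  rw [a6, p3, b6] at q2
  exact q2

/-- The left factor `U` of a singular value decomposition of `L`. -/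
def svdLeft {n m : ℕ} (L : Matrix (Fin n) (Fin m) ℝ) : Matrix (Fin n) (Fin L.rank) ℝ :=
  (exists_isSVD L).choose

/-- The right factor `V` of the same singular value decomposition of `L`. -/
def svdRight {n m : ℕ} (L : Matrix (Fin n) (Fin m) ℝ) : Matrix (Fin m) (Fin L.rank) ℝ :=
  (exists_isSVD L).choose_spec.choose_spec.choose

/-- Joint incoherence `(n m / rank L) max_{k,l} |⟨e_k, U Vᵀ e_l⟩|²`, where `L = U Σ Vᵀ` is a
singular value decomposition; by `IsSVD.mul_transpose_unique` its choice is immaterial. -/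
def jointIncoherence {n m : ℕ} (L : Matrix (Fin n) (Fin m) ℝ) : ℝ :=
  ((n : ℝ) * (m : ℝ) / (L.rank : ℝ)) *
    ⨆ kl : Fin n × Fin m, |(svdLeft L * (svdRight L)ᵀ) kl.1 kl.2| ^ 2

end

end GaussianLoadings

open GaussianLoadings

/-!
If `Q` is orthogonal then `Q * G` has the law of `G`, and `G ↦ Q * G` turns the polar factor
`W = U Vᵀ` of the loadings into `W Qᵀ`. The vector `W e_l` may therefore be replaced by
`W x / ‖x‖` with `x` a standard normal vector independent of `G`, and `‖W x‖² / ‖x‖²` (for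
`rightIncoherence`) or `⟨Wᵀ e_k, x⟩² / ‖x‖²` (for `jointIncoherence`) is at most a multiple of the
share of `‖x‖²` carried by a subspace of dimension `r`, respectively `1`. This share is a ratio of
chi-squared variables, its tail is bounded by a Chernoff argument, and a union bound over `l`,
respectively `(k, l)`, gives the probabilistic estimates. The permeance enters through the row
bound `‖Wᵀ e_k‖² ≤ r / (n ν)`: the projection `p` of `e_k` onto a subspace of `ran S` is `S v` for
some `v`, so `‖p‖² = (S v)_k ≤ √r ‖v‖` while `n ν ‖v‖² ≤ ‖p‖²`. Measurability of the polar factor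
comes from the limit `W = lim L (√(Lᵀ L) + ε)⁻¹` as `ε` decreases to `0`.
-/

namespace GaussianLoadings

section ChiSquared

variable {ι κ : Type*} [Fintype ι] [Fintype κ]

theorem integral_exp_mul_sq_gaussianReal {θ : ℝ} (hθ : θ < 1 / 2) :
    ∫ x, Real.exp (θ * x ^ 2) ∂(gaussianReal 0 1) = (√(1 - 2 * θ))⁻¹ := by
  have hpdf (x : ℝ) : gaussianPDFReal 0 1 x • Real.exp (θ * x ^ 2)
      = (√(2 * Real.pi))⁻¹ * Real.exp (-(1 / 2 - θ) * x ^ 2) := by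
    simp only [gaussianPDFReal, smul_eq_mul, NNReal.coe_one, mul_one, sub_zero]
    rw [mul_assoc, ← Real.exp_add]
    ring_nf
  have hpos : 0 < 1 - 2 * θ := by linarith
  have hdiv : Real.pi / (1 / 2 - θ) = 2 * Real.pi / (1 - 2 * θ) := by
    rw [div_eq_div_iff (by linarith) hpos.ne']
    ring
  rw [integral_gaussianReal_eq_integral_smul one_ne_zero]
  simp_rw [hpdf]
  rw [integral_const_mul, integral_gaussian, hdiv, Real.sqrt_div (by positivity), ← mul_div_assoc,
    inv_mul_cancel₀ (by positivity), one_div]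

theorem integral_exp_mul_sum_sq_pi_gaussianReal {θ : ℝ} (hθ : θ < 1 / 2) :
    ∫ x : ι → ℝ, Real.exp (θ * ∑ i, x i ^ 2) ∂(Measure.pi fun _ => gaussianReal 0 1)
      = (√(1 - 2 * θ))⁻¹ ^ Fintype.card ι := by
  simp_rw [Finset.mul_sum, Real.exp_sum]
  rw [integral_fintype_prod_eq_prod fun (_ : ι) (x : ℝ) => Real.exp (θ * x ^ 2)]
  simp [integral_exp_mul_sq_gaussianReal hθ]

theorem integrable_exp_mul_sum_sq_pi_gaussianReal {θ : ℝ} (hθ : θ < 1 / 2) :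
    Integrable (fun x : ι → ℝ => Real.exp (θ * ∑ i, x i ^ 2))
      (Measure.pi fun _ => gaussianReal 0 1) := by
  refine Integrable.of_integral_ne_zero ?_
  rw [integral_exp_mul_sum_sq_pi_gaussianReal hθ]
  have : 0 < 1 - 2 * θ := by linarith
  positivity

theorem measure_le_sum_sq_pi_gaussianReal {θ : ℝ} (h0 : 0 ≤ θ) (hθ : θ < 1 / 2) (y : ℝ) :
    (Measure.pi fun _ : ι => gaussianReal 0 1) {x | y ≤ ∑ i, x i ^ 2}
      ≤ ENNReal.ofReal ((√(1 - 2 * θ))⁻¹ ^ Fintype.card ι * Real.exp (-θ * y)) := by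
  have h := measure_ge_le_exp_mul_mgf (μ := Measure.pi fun _ : ι => gaussianReal 0 1)
    (X := fun x : ι → ℝ => ∑ i, x i ^ 2) y h0 (integrable_exp_mul_sum_sq_pi_gaussianReal hθ)
  rw [mgf, integral_exp_mul_sum_sq_pi_gaussianReal hθ, mul_comm] at h
  rw [← ofReal_measureReal]
  exact ENNReal.ofReal_le_ofReal h

theorem measure_le_gaussianReal {s : ℝ} (hs : 0 ≤ s) :
    gaussianReal 0 1 {x | s ≤ x} ≤ ENNReal.ofReal (Real.exp (-(s ^ 2) / 2)) := by
  have h := measure_ge_le_exp_mul_mgf (μ := gaussianReal 0 1) (X := id) s hs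
    (integrable_exp_mul_gaussianReal s)
  rw [mgf_id_gaussianReal, ← Real.exp_add] at h
  rw [← ofReal_measureReal]
  refine ENNReal.ofReal_le_ofReal (h.trans (Real.exp_le_exp.2 (le_of_eq ?_)))
  simp only [NNReal.coe_one]
  ring

theorem measure_le_sq_gaussianReal {y : ℝ} (hy : 0 ≤ y) :
    gaussianReal 0 1 {x | y ≤ x ^ 2} ≤ ENNReal.ofReal (2 * Real.exp (-(1 / 2) * y)) := by
  have hright := measure_le_gaussianReal (Real.sqrt_nonneg y)
  have hleft : gaussianReal 0 1 {x | √y ≤ -x} ≤ ENNReal.ofReal (Real.exp (-(√y ^ 2) / 2)) := by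
    have hneg : MeasurePreserving (fun x : ℝ => -x) (gaussianReal 0 1) (gaussianReal 0 1) :=
      ⟨measurable_neg, by rw [gaussianReal_map_neg, neg_zero]⟩
    exact (hneg.measure_preimage measurableSet_Ici.nullMeasurableSet).trans_le hright
  have hsub : {x : ℝ | y ≤ x ^ 2} ⊆ {x | √y ≤ x} ∪ {x | √y ≤ -x} := fun x hx =>
    le_abs.1 (Real.sqrt_le_sqrt hx |>.trans_eq (Real.sqrt_sq_eq_abs x))
  calc _ ≤ _ := (measure_mono hsub).trans (measure_union_le _ _)
    _ ≤ _ := add_le_add hright hleft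
    _ = _ := by
      rw [← ENNReal.ofReal_add (by positivity) (by positivity), Real.sq_sqrt hy, ← two_mul]
      ring_nf

theorem measure_prod_le_of_exp_tail {α β : Type*} [MeasurableSpace α] [MeasurableSpace β]
    {μ : Measure α} {ν : Measure β} [SFinite μ] [SFinite ν] {X : α → ℝ} {Y : β → ℝ}
    (hX : Measurable X) (hY : Measurable Y) (hY0 : ∀ b, 0 ≤ Y b) {K s : ℝ} (hK : 0 ≤ K)
    (hint : Integrable (fun b => Real.exp (-s * Y b)) ν)
    (htail : ∀ y, 0 ≤ y → μ {a | y ≤ X a} ≤ ENNReal.ofReal (K * Real.exp (-s * y))) :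
    (μ.prod ν) {p | Y p.2 ≤ X p.1} ≤ ENNReal.ofReal (K * ∫ b, Real.exp (-s * Y b) ∂ν) := by
  have hs : MeasurableSet {p : α × β | Y p.2 ≤ X p.1} :=
    measurableSet_le (hY.comp measurable_snd) (hX.comp measurable_fst)
  rw [Measure.prod_apply_symm hs,
    ← integral_const_mul, ofReal_integral_eq_lintegral_ofReal (hint.const_mul K)
      (Filter.Eventually.of_forall fun b => by positivity)]
  exact lintegral_mono fun b => htail _ (hY0 b)

theorem inv_sqrt_one_add_le {x : ℝ} (hx : 0 ≤ x) :
    (√(1 + x))⁻¹ ≤ Real.exp (-(x / (1 + x)) / 2) := by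
  have h := Real.add_one_le_exp (-(x / (1 + x)))
  have hx' : -(x / (1 + x)) + 1 = (1 + x)⁻¹ := by field_simp; ring
  rw [Real.exp_half, ← Real.sqrt_inv, ← hx']
  exact Real.sqrt_le_sqrt h

theorem measure_prod_pi_gaussianReal_le_of_exp_tail {α : Type*} [MeasurableSpace α]
    {μ : Measure α} [SFinite μ] {X : α → ℝ} (hX : Measurable X) {K s : ℝ} (hK : 0 ≤ K)
    (hs : 0 ≤ s) (htail : ∀ y, 0 ≤ y → μ {a | y ≤ X a} ≤ ENNReal.ofReal (K * Real.exp (-s * y)))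
    {p : ℝ} (hp0 : 0 ≤ p) (hp1 : p < 1) :
    (μ.prod (Measure.pi fun _ : κ => gaussianReal 0 1))
        {q | p * (X q.1 + ∑ i, q.2 i ^ 2) ≤ X q.1}
      ≤ ENNReal.ofReal (K * Real.exp (-(Fintype.card κ * (s * p / (1 - p + 2 * s * p))))) := by
  set c := p / (1 - p) with hc
  have hp : 0 < 1 - p := by linarith
  have hc0 : 0 ≤ c := by positivity
  have hθ : -s * c < 1 / 2 := by linarith [mul_nonneg hs hc0]
  have hset : {q : α × (κ → ℝ) | p * (X q.1 + ∑ i, q.2 i ^ 2) ≤ X q.1}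
      = {q | c * ∑ i, q.2 i ^ 2 ≤ X q.1} := by
    ext q
    rw [Set.mem_ofPred_eq, Set.mem_ofPred_eq, hc, div_mul_eq_mul_div, div_le_iff₀ hp]
    constructor <;> intro h <;> linarith
  have hint := integrable_exp_mul_sum_sq_pi_gaussianReal (ι := κ) hθ
  have h := measure_prod_le_of_exp_tail (ν := Measure.pi fun _ : κ => gaussianReal 0 1) hX
    (Y := fun x => c * ∑ i, x i ^ 2) (by fun_prop) (fun x => by positivity) hK
    (by simpa only [← mul_assoc] using hint) htail
  simp_rw [← mul_assoc] at h
  rw [integral_exp_mul_sum_sq_pi_gaussianReal hθ] at h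
  rw [hset]
  refine h.trans (ENNReal.ofReal_le_ofReal (mul_le_mul_of_nonneg_left ?_ hK))
  calc (√(1 - 2 * (-s * c)))⁻¹ ^ Fintype.card κ
      = (√(1 + 2 * s * c))⁻¹ ^ Fintype.card κ := by ring_nf
    _ ≤ Real.exp (-(2 * s * c / (1 + 2 * s * c)) / 2) ^ Fintype.card κ :=
        pow_le_pow_left₀ (by positivity) (inv_sqrt_one_add_le (by positivity)) _
    _ = _ := by
        rw [← Real.exp_nat_mul, hc]
        congr 1
        field_simp

theorem sqrt_mul_exp_one_sub_pow_le {t : ℝ} (ht : 0 ≤ t) {r : ℕ} (hr : 2 ≤ r) :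
    √(t * Real.exp (1 - t)) ^ r ≤ 2 * Real.exp (-t / 2) := by
  have hexp (x : ℝ) : x * Real.exp (1 - x) ≤ 1 := by
    calc x * Real.exp (1 - x) ≤ Real.exp (x - 1) * Real.exp (1 - x) := by
          gcongr
          linarith [Real.add_one_le_exp (x - 1)]
      _ = 1 := by rw [← Real.exp_add]; simp
  calc √(t * Real.exp (1 - t)) ^ r ≤ √(t * Real.exp (1 - t)) ^ 2 :=
        pow_le_pow_of_le_one (Real.sqrt_nonneg _) (Real.sqrt_le_one.2 (hexp t)) hr
    _ = 2 * (t / 2 * Real.exp (1 - t / 2)) * Real.exp (-t / 2) := by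
        rw [Real.sq_sqrt (by positivity), mul_assoc 2, mul_assoc (t / 2), ← Real.exp_add]
        ring_nf
    _ ≤ 2 * 1 * Real.exp (-t / 2) := by gcongr; exact hexp _
    _ = 2 * Real.exp (-t / 2) := by ring

theorem measure_prod_pi_fraction_le_of_two_le_card (hι : 2 ≤ Fintype.card ι) {t : ℝ} (ht : 1 < t)
    (hlt : Fintype.card ι * t / (Fintype.card ι + Fintype.card κ) < 1) :
    ((Measure.pi fun _ : ι => gaussianReal 0 1).prod (Measure.pi fun _ : κ => gaussianReal 0 1))
        {q | Fintype.card ι * t / (Fintype.card ι + Fintype.card κ) *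
          (∑ i, q.1 i ^ 2 + ∑ j, q.2 j ^ 2) ≤ ∑ i, q.1 i ^ 2}
      ≤ ENNReal.ofReal (2 * Real.exp (-t / 2)) := by
  -- the Chernoff parameter `s = (1 - 1 / t) / 2` is optimal for the chi-squared tail at `t`
  have ht0 : 0 < t := by linarith
  set s := (1 - 1 / t) / 2 with hs
  have hs0 : 0 ≤ s := by
    have : 1 / t ≤ 1 := by rw [div_le_one ht0]; exact ht.le
    linarith
  have hs1 : s < 1 / 2 := by
    have : 0 < 1 / t := by positivity
    linarith
  have hcard : (0 : ℝ) < Fintype.card ι := by positivity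
  rw [div_lt_one (by positivity)] at hlt
  have hκ : (0 : ℝ) < Fintype.card κ := by nlinarith
  refine (measure_prod_pi_gaussianReal_le_of_exp_tail (X := fun x : ι → ℝ => ∑ i, x i ^ 2)
    (by fun_prop) (by positivity) hs0 (fun y _ => measure_le_sum_sq_pi_gaussianReal hs0 hs1 y)
    (by positivity) ((div_lt_one (by positivity)).2 hlt)).trans (ENNReal.ofReal_le_ofReal ?_)
  refine le_trans (le_of_eq ?_) (sqrt_mul_exp_one_sub_pow_le ht0.le hι)
  have hK : (√(1 - 2 * s))⁻¹ = √t := by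
    rw [← Real.sqrt_inv, hs]
    congr 1
    field_simp
    ring
  rw [hK, Real.sqrt_mul ht0.le, mul_pow, ← Real.exp_half, ← Real.exp_nat_mul, hs]
  congr 2
  have hden : 1 - Fintype.card ι * t / (Fintype.card ι + Fintype.card κ) + 2 * s *
      (Fintype.card ι * t / (Fintype.card ι + Fintype.card κ))
        = Fintype.card κ / (Fintype.card ι + Fintype.card κ : ℝ) := by
    rw [hs]
    field_simp
    ring
  rw [← hs, hden, hs]
  field_simp
  ring

theorem measure_prod_pi_fraction_le_of_card_eq_one (hι : Fintype.card ι = 1) {t : ℝ} (ht : 0 ≤ t)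
    (hlt : t / (1 + Fintype.card κ) < 1) :
    ((Measure.pi fun _ : ι => gaussianReal 0 1).prod (Measure.pi fun _ : κ => gaussianReal 0 1))
        {q | t / (1 + Fintype.card κ) * (∑ i, q.1 i ^ 2 + ∑ j, q.2 j ^ 2) ≤ ∑ i, q.1 i ^ 2}
      ≤ ENNReal.ofReal (4 * Real.exp (-t / 2)) := by
  obtain ⟨_⟩ := Fintype.card_eq_one_iff_nonempty_unique.1 hι
  have htail (y : ℝ) (hy : 0 ≤ y) :
      (Measure.pi fun _ : ι => gaussianReal 0 1) {x | y ≤ ∑ i, x i ^ 2}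
        ≤ ENNReal.ofReal (2 * Real.exp (-(1 / 2) * y)) := by
    have hmeas : MeasurableSet {x : ℝ | y ≤ x ^ 2} :=
      measurableSet_le measurable_const (by fun_prop)
    simp_rw [Fintype.sum_unique]
    exact ((measurePreserving_eval (fun _ : ι => gaussianReal 0 1) default).measure_preimage
      hmeas.nullMeasurableSet).trans_le (measure_le_sq_gaussianReal hy)
  refine (measure_prod_pi_gaussianReal_le_of_exp_tail (X := fun x : ι → ℝ => ∑ i, x i ^ 2)
    (by fun_prop) zero_le_two one_half_pos.le htail (by positivity) hlt).trans
    (ENNReal.ofReal_le_ofReal ?_)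
  rw [div_lt_one (by positivity)] at hlt
  have hexponent : -(Fintype.card κ * (1 / 2 * (t / (1 + Fintype.card κ)) /
      (1 - t / (1 + Fintype.card κ) + 2 * (1 / 2) * (t / (1 + Fintype.card κ)))))
        ≤ 1 / 2 + -t / 2 := by
    have hsub : Fintype.card κ * t / (1 + Fintype.card κ) = t - t / (1 + Fintype.card κ) := by
      field_simp
      ring
    have := (div_le_one (by positivity)).2 hlt.le
    ring_nf at hsub this ⊢
    linarith
  have hexp_half : Real.exp (1 / 2) ≤ 2 := by
    rw [Real.exp_half, Real.sqrt_le_left zero_le_two]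
    linarith [Real.exp_one_lt_d9]
  calc _ ≤ 2 * Real.exp (1 / 2 + -t / 2) := by gcongr
    _ = 2 * Real.exp (1 / 2) * Real.exp (-t / 2) := by rw [Real.exp_add, mul_assoc]
    _ ≤ 2 * 2 * Real.exp (-t / 2) := by gcongr
    _ = _ := by ring

theorem measure_sum_sq_nonpos_pi_gaussianReal [Nonempty ι] :
    (Measure.pi fun _ : ι => gaussianReal 0 1) {x | ∑ i, x i ^ 2 ≤ 0} = 0 := by
  have := nullSingletonClass_gaussianReal (μ := 0) (v := 1) one_ne_zero
  refine measure_mono_null (fun x hx => ?_)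
    (measure_singleton (μ := Measure.pi fun _ : ι => gaussianReal 0 1) 0)
  have h := (Finset.sum_eq_zero_iff_of_nonneg fun i _ => sq_nonneg (x i)).1
    (le_antisymm hx (by positivity))
  exact funext fun i => pow_eq_zero_iff two_ne_zero |>.1 (h i (Finset.mem_univ i))

theorem measure_prod_pi_fraction_eq_zero [Nonempty ι] {t : ℝ} (ht : 1 < t)
    (hle : 1 ≤ Fintype.card ι * t / (Fintype.card ι + Fintype.card κ)) :
    ((Measure.pi fun _ : ι => gaussianReal 0 1).prod (Measure.pi fun _ : κ => gaussianReal 0 1))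
        {q | Fintype.card ι * t / (Fintype.card ι + Fintype.card κ) *
          (∑ i, q.1 i ^ 2 + ∑ j, q.2 j ^ 2) ≤ ∑ i, q.1 i ^ 2} = 0 := by
  cases isEmpty_or_nonempty κ with
  | inl _ =>
    refine measure_mono_null (fun q hq => ?_)
      (measurePreserving_fst.quasiMeasurePreserving.preimage_null
        measure_sum_sq_nonpos_pi_gaussianReal)
    rw [Set.mem_preimage, Set.mem_ofPred_eq]
    rw [Set.mem_ofPred_eq] at hq
    have hcard : (Fintype.card ι : ℝ) ≠ 0 := by positivity
    simp only [Fintype.card_eq_zero, Nat.cast_zero, add_zero, Finset.univ_eq_empty,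
      Finset.sum_empty, mul_div_cancel_left₀ t hcard] at hq
    nlinarith
  | inr _ =>
    refine measure_mono_null (fun q hq => ?_)
      (measurePreserving_snd.quasiMeasurePreserving.preimage_null
        measure_sum_sq_nonpos_pi_gaussianReal)
    rw [Set.mem_preimage, Set.mem_ofPred_eq]
    rw [Set.mem_ofPred_eq] at hq
    have hsum : 0 ≤ ∑ i, q.1 i ^ 2 + ∑ j, q.2 j ^ 2 := by positivity
    linarith [le_mul_of_one_le_left hsum hle]

theorem measure_prod_pi_fraction_le [Nonempty ι] (t : ℝ) :
    ((Measure.pi fun _ : ι => gaussianReal 0 1).prod (Measure.pi fun _ : κ => gaussianReal 0 1))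
        {q | Fintype.card ι * t / (Fintype.card ι + Fintype.card κ) *
          (∑ i, q.1 i ^ 2 + ∑ j, q.2 j ^ 2) ≤ ∑ i, q.1 i ^ 2}
      ≤ ENNReal.ofReal (4 * Real.exp (-t / 2)) := by
  rcases le_or_gt t 1 with ht | ht
  · refine prob_le_one.trans (ENNReal.one_le_ofReal.2 ?_)
    linarith [Real.add_one_le_exp (-t / 2)]
  rcases le_or_gt 1 (Fintype.card ι * t / (Fintype.card ι + Fintype.card κ)) with hle | hlt
  · rw [measure_prod_pi_fraction_eq_zero ht hle]
    exact zero_le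
  rcases (Nat.succ_le_of_lt (Fintype.card_pos (α := ι))).eq_or_lt with hι | hι
  · simpa only [← hι, Nat.succ_eq_add_one, zero_add, Nat.cast_one, one_mul] using
      measure_prod_pi_fraction_le_of_card_eq_one hι.symm (by linarith)
        (by simpa [← hι] using hlt)
  · refine (measure_prod_pi_fraction_le_of_two_le_card hι ht hlt).trans ?_
    gcongr
    norm_num

end ChiSquared

section GaussianProjection

open scoped RealInnerProductSpace

variable {E : Type*} [NormedAddCommGroup E] [InnerProductSpace ℝ E]

theorem norm_sq_sum_smul_orthonormalBasis {ι : Type*} [Fintype ι] (b : OrthonormalBasis ι ℝ E)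
    (x : ι → ℝ) : ‖∑ i, x i • b i‖ ^ 2 = ∑ i, x i ^ 2 := by
  rw [← real_inner_self_eq_norm_sq, b.orthonormal.inner_sum]
  simp [sq]

theorem norm_sq_mul_norm_sq_starProjection_span_singleton (w x : E) :
    ‖w‖ ^ 2 * ‖(ℝ ∙ w).starProjection x‖ ^ 2 = ⟪w, x⟫ ^ 2 := by
  rw [Submodule.starProjection_singleton, norm_smul, mul_pow, Real.norm_eq_abs, sq_abs]
  rcases eq_or_ne w 0 with rfl | hw
  · simp
  · have := norm_ne_zero_iff.2 hw
    simp only [RCLike.ofReal_real_eq_id, id_eq]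
    field_simp

variable [FiniteDimensional ℝ E] [MeasurableSpace E] [BorelSpace E]

theorem stdGaussian_eq_map_prod_orthonormalBasis {ι κ : Type*} [Fintype ι] [Fintype κ]
    {K : Submodule ℝ E} (b : OrthonormalBasis ι ℝ K) (c : OrthonormalBasis κ ℝ Kᗮ) :
    stdGaussian E = ((Measure.pi fun _ : ι => gaussianReal 0 1).prod
      (Measure.pi fun _ : κ => gaussianReal 0 1)).map
        fun q => ((∑ i, q.1 i • b i : K) + (∑ j, q.2 j • c j : Kᗮ) : E) := by
  rw [stdGaussian_eq_map_pi_orthonormalBasis ((b.prod c).map K.orthogonalDecomposition.symm),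
    ← (measurePreserving_sumPiEquivProdPi fun _ : ι ⊕ κ => gaussianReal 0 1).map_eq,
    Measure.map_map (by fun_prop) (by fun_prop)]
  congr 1
  ext x
  simp [Fintype.sum_sum_type, MeasurableEquiv.coe_sumPiEquivProdPi, Equiv.sumPiEquivProdPi]

theorem stdGaussian_le_norm_sq_starProjection_le {K : Submodule ℝ E} (hK : K ≠ ⊥) (t : ℝ) :
    stdGaussian E {x | Module.finrank ℝ K * t / Module.finrank ℝ E * ‖x‖ ^ 2
        ≤ ‖K.starProjection x‖ ^ 2} ≤ ENNReal.ofReal (4 * Real.exp (-t / 2)) := by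
  have : Nontrivial K := Submodule.nontrivial_iff_ne_bot.2 hK
  have : Nonempty (Fin (Module.finrank ℝ K)) := Fin.pos_iff_nonempty.1 Module.finrank_pos
  have hmeas : MeasurableSet {x : E | Module.finrank ℝ K * t / Module.finrank ℝ E * ‖x‖ ^ 2
      ≤ ‖K.starProjection x‖ ^ 2} := measurableSet_le (by fun_prop) (by fun_prop)
  have hdim : (Module.finrank ℝ E : ℝ) = Module.finrank ℝ K + Module.finrank ℝ Kᗮ := by
    exact_mod_cast K.finrank_add_finrank_orthogonal.symm
  have hproj (x : K) (y : Kᗮ) : K.starProjection (x + y : E) = x := by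
    rw [map_add, K.starProjection_eq_self_iff.2 x.2,
      K.starProjection_apply_eq_zero_iff.2 y.2, add_zero]
  have hpyth (x : K) (y : Kᗮ) : ‖(x + y : E)‖ ^ 2 = ‖x‖ ^ 2 + ‖y‖ ^ 2 := by
    simpa only [sq, Submodule.coe_norm] using norm_add_sq_eq_norm_sq_add_norm_sq_real
      (K.inner_right_of_mem_orthogonal x.2 y.2)
  rw [stdGaussian_eq_map_prod_orthonormalBasis (stdOrthonormalBasis ℝ K)
    (stdOrthonormalBasis ℝ Kᗮ), Measure.map_apply (by fun_prop) hmeas, hdim]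
  simpa only [Set.preimage_ofPred_eq, hproj, hpyth, ← Submodule.coe_norm,
    norm_sq_sum_smul_orthonormalBasis, Fintype.card_fin] using
      measure_prod_pi_fraction_le (ι := Fin (Module.finrank ℝ K))
        (κ := Fin (Module.finrank ℝ Kᗮ)) t

theorem stdGaussian_le_inner_sq_le [Nontrivial E] {w : E} {β : ℝ} (hβ : 0 < β)
    (hw : ‖w‖ ^ 2 ≤ β) (t : ℝ) :
    stdGaussian E {x | β * (t / Module.finrank ℝ E) * ‖x‖ ^ 2 ≤ ⟪w, x⟫ ^ 2}
      ≤ ENNReal.ofReal (4 * Real.exp (-t / 2)) := by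
  obtain ⟨u, hu, hwu⟩ : ∃ u : E, u ≠ 0 ∧ ∀ x, ⟪w, x⟫ ^ 2 ≤ β * ‖(ℝ ∙ u).starProjection x‖ ^ 2 := by
    rcases eq_or_ne w 0 with rfl | hw0
    · obtain ⟨u, hu⟩ := exists_ne (0 : E)
      refine ⟨u, hu, fun x => ?_⟩
      rw [inner_zero_left, zero_pow two_ne_zero]
      positivity
    · refine ⟨w, hw0, fun x => ?_⟩
      rw [← norm_sq_mul_norm_sq_starProjection_span_singleton]
      gcongr
  refine le_trans (measure_mono fun x hx => ?_) (stdGaussian_le_norm_sq_starProjection_le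
    (K := ℝ ∙ u) (Submodule.span_singleton_eq_bot.not.2 hu) t)
  rw [Set.mem_ofPred_eq, finrank_span_singleton hu, Nat.cast_one, one_mul]
  refine le_of_mul_le_mul_left (le_trans (le_of_eq ?_) (le_trans hx (hwu x))) hβ
  ring

end GaussianProjection

section GaussianVectors

variable {E : Type*} [NormedAddCommGroup E]

theorem ae_linearIndependent_pi [NormedSpace ℝ E] [FiniteDimensional ℝ E]
    [MeasurableSpace E] [BorelSpace E] {μ : Measure E} [SigmaFinite μ]
    (hμ : ∀ K : Submodule ℝ E, K ≠ ⊤ → μ K = 0) {r : ℕ} (hr : r ≤ Module.finrank ℝ E) :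
    ∀ᵐ v ∂(Measure.pi fun _ : Fin r => μ), LinearIndependent ℝ v := by
  induction r with
  | zero => exact Filter.Eventually.of_forall fun v => linearIndependent_empty_type
  | succ r ih =>
    have hmeas : MeasurableSet {p : E × (Fin r → E) |
        LinearIndependent ℝ (Fin.cons p.1 p.2 : Fin (r + 1) → E)} := by
      have hc : Continuous fun p : E × (Fin r → E) => (Fin.cons p.1 p.2 : Fin (r + 1) → E) := by
        fun_prop
      exact (isOpen_setOfPred_linearIndependent.preimage hc).measurableSet
    have hcons : ∀ᵐ p ∂(μ.prod (Measure.pi fun _ : Fin r => μ)),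
        LinearIndependent ℝ (Fin.cons p.1 p.2 : Fin (r + 1) → E) := by
      rw [ae_iff]
      refine (Measure.prod_apply_symm hmeas.compl).trans (lintegral_eq_zero_of_ae_eq_zero ?_)
      filter_upwards [ih (by omega)] with v hv
      have hspan : Submodule.span ℝ (Set.range v) ≠ ⊤ := fun htop => by
        have h := finrank_range_le_card (R := ℝ) v
        rw [Set.finrank, htop, finrank_top, Fintype.card_fin] at h
        omega
      refine measure_mono_null (fun x hx => ?_) (hμ _ hspan)
      by_contra hx'
      exact hx (linearIndependent_finCons.2 ⟨hv, hx'⟩)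
    have hsplit := measurePreserving_piFinSuccAbove (fun _ : Fin (r + 1) => μ) 0
    filter_upwards [hsplit.quasiMeasurePreserving.ae hcons] with v hv
    simpa only [MeasurableEquiv.piFinSuccAbove, Fin.insertNthEquiv_zero, MeasurableEquiv.coe_mk,
      Equiv.symm_symm, Fin.consEquiv_symm_apply, Fin.cons_self_tail] using hv

variable [InnerProductSpace ℝ E] [FiniteDimensional ℝ E] [MeasurableSpace E] [BorelSpace E]

theorem stdGaussian_submodule_eq_zero {K : Submodule ℝ E} (hK : K ≠ ⊤) :
    stdGaussian E K = 0 := by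
  have : Nontrivial Kᗮ := Submodule.nontrivial_iff_ne_bot.2 (by simpa using hK)
  have : Nonempty (Fin (Module.finrank ℝ Kᗮ)) := Fin.pos_iff_nonempty.1 Module.finrank_pos
  rw [stdGaussian_eq_map_prod_orthonormalBasis (stdOrthonormalBasis ℝ K)
    (stdOrthonormalBasis ℝ Kᗮ),
    Measure.map_apply (by fun_prop) K.closed_of_finiteDimensional.measurableSet]
  refine measure_mono_null (fun q hq => ?_)
    (measurePreserving_snd.quasiMeasurePreserving.preimage_null
      measure_sum_sq_nonpos_pi_gaussianReal)
  have hmem := (K.add_mem_iff_right (Submodule.coe_mem _)).1 hq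
  have hzero := K.inf_orthogonal_eq_bot.le ⟨hmem, Submodule.coe_mem _⟩
  rw [Set.mem_preimage, Set.mem_ofPred_eq, ← norm_sq_sum_smul_orthonormalBasis
    (stdOrthonormalBasis ℝ Kᗮ), Submodule.coe_norm, (Submodule.mem_bot ℝ).1 hzero]
  simp

theorem ae_stdGaussian_ne_zero [Nontrivial E] : ∀ᵐ x ∂(stdGaussian E), x ≠ 0 := by
  have h := stdGaussian_submodule_eq_zero (E := E) bot_ne_top
  simpa [ae_iff] using h

end GaussianVectors

section Orthogonal

variable {m n : Type*} [Fintype m] [Fintype n] [DecidableEq n]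

theorem norm_toEuclideanLin_of_transpose_mul_self {U : Matrix m n ℝ} (hU : Uᵀ * U = 1)
    (x : EuclideanSpace ℝ n) : ‖toEuclideanLin U x‖ = ‖x‖ := by
  rw [← sq_eq_sq₀ (norm_nonneg _) (norm_nonneg _), ← real_inner_self_eq_norm_sq,
    ← real_inner_self_eq_norm_sq, EuclideanSpace.inner_eq_star_dotProduct,
    EuclideanSpace.inner_eq_star_dotProduct]
  simp [Matrix.dotProduct_mulVec, Matrix.vecMul_mulVec, hU, Matrix.ofLp_toLpLin]

theorem exists_orthogonal_toEuclideanLin_eq {v w : EuclideanSpace ℝ n} (h : ‖v‖ = ‖w‖) :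
    ∃ Q : Matrix n n ℝ, Qᵀ * Q = 1 ∧ toEuclideanLin Q v = w := by
  let f := (ℝ ∙ (v - w))ᗮ.reflection
  let Q := toEuclideanLin.symm f.toLinearMap
  have hQ : toEuclideanLin Q = f.toLinearMap := LinearEquiv.apply_symm_apply _ _
  refine ⟨Q, ?_, by rw [hQ]; exact Submodule.reflection_sub h⟩
  have hadj := f.toLinearIsometry.adjoint_comp_self'
  apply toEuclideanLin.injective
  rw [← conjTranspose_eq_transpose_of_trivial, toLpLin_mul_same,
    toEuclideanLin_conjTranspose_eq_adjoint, hQ, toLpLin_one]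
  exact hadj

end Orthogonal

section GaussianMatrices

variable {m r : ℕ}

instance isProbabilityMeasure_stdNormalMatrix : IsProbabilityMeasure (stdNormalMatrix m r) :=
  inferInstanceAs (IsProbabilityMeasure
    (Measure.pi fun _ : Fin m => Measure.pi fun _ : Fin r => gaussianReal 0 1))

instance borelSpace_matrix : BorelSpace (Matrix (Fin m) (Fin r) ℝ) :=
  inferInstanceAs (BorelSpace (Fin m → Fin r → ℝ))

theorem measurePreserving_curry_gaussianReal (m r : ℕ) :
    MeasurePreserving (MeasurableEquiv.curry (Fin m) (Fin r) ℝ)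
      (Measure.pi fun _ => gaussianReal 0 1) (stdNormalMatrix m r) := by
  refine ⟨MeasurableEquiv.measurable _, ?_⟩
  have h := Measure.infinitePi_map_curry fun (_ : Fin m) (_ : Fin r) => gaussianReal 0 1
  simp only [Measure.infinitePi_eq_pi] at h
  exact h

theorem measurePreserving_transpose (m r : ℕ) :
    MeasurePreserving (Matrix.transpose : Matrix (Fin m) (Fin r) ℝ → Matrix (Fin r) (Fin m) ℝ)
      (stdNormalMatrix m r) (stdNormalMatrix r m) :=
  (measurePreserving_curry_gaussianReal r m).comp ((measurePreserving_arrowCongr'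
    (fun _ => gaussianReal 0 1) (fun _ => gaussianReal 0 1) (Equiv.prodComm (Fin m) (Fin r))
    (MeasurableEquiv.refl ℝ) fun _ => MeasurePreserving.id _).comp
      (measurePreserving_curry_gaussianReal m r).symm)

theorem measurePreserving_toLp_stdGaussian {ι : Type*} [Fintype ι] :
    MeasurePreserving (MeasurableEquiv.toLp 2 (ι → ℝ)) (Measure.pi fun _ => gaussianReal 0 1)
      (stdGaussian (EuclideanSpace ℝ ι)) :=
  ⟨MeasurableEquiv.measurable _, map_pi_eq_stdGaussian⟩

theorem measurePreserving_mulVec {ι : Type*} [Fintype ι] [DecidableEq ι] {Q : Matrix ι ι ℝ}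
    (hQ : Qᵀ * Q = 1) : MeasurePreserving (fun x : ι → ℝ => Q *ᵥ x)
      (Measure.pi fun _ => gaussianReal 0 1) (Measure.pi fun _ => gaussianReal 0 1) := by
  let f : EuclideanSpace ℝ ι ≃ₗᵢ[ℝ] EuclideanSpace ℝ ι :=
    (LinearIsometry.mk (toEuclideanLin Q)
      (norm_toEuclideanLin_of_transpose_mul_self hQ)).toLinearIsometryEquiv rfl
  have hf : MeasurePreserving f (stdGaussian _) (stdGaussian _) :=
    ⟨f.continuous.measurable, stdGaussian_map f⟩
  exact measurePreserving_toLp_stdGaussian.symm.comp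
    (hf.comp measurePreserving_toLp_stdGaussian)

theorem measurePreserving_mul_left {Q : Matrix (Fin m) (Fin m) ℝ} (hQ : Qᵀ * Q = 1) :
    MeasurePreserving (fun G : Matrix (Fin m) (Fin r) ℝ => Q * G)
      (stdNormalMatrix m r) (stdNormalMatrix m r) := by
  have hcols : MeasurePreserving (fun (G : Matrix (Fin r) (Fin m) ℝ) j => Q *ᵥ G j)
      (stdNormalMatrix r m) (stdNormalMatrix r m) :=
    measurePreserving_pi _ _ fun _ => measurePreserving_mulVec hQ
  exact (measurePreserving_transpose r m).comp (hcols.comp (measurePreserving_transpose m r))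

theorem ae_rank_stdNormalMatrix (hrm : r ≤ m) : ∀ᵐ G ∂(stdNormalMatrix m r), G.rank = r := by
  have hcols : MeasurePreserving
      (fun (G : Matrix (Fin r) (Fin m) ℝ) j => MeasurableEquiv.toLp 2 (Fin m → ℝ) (G j))
      (stdNormalMatrix r m) (Measure.pi fun _ => stdGaussian (EuclideanSpace ℝ (Fin m))) :=
    measurePreserving_pi _ _ fun _ => measurePreserving_toLp_stdGaussian
  have hind := (hcols.comp (measurePreserving_transpose m r)).quasiMeasurePreserving.ae
    (ae_linearIndependent_pi (fun _ => stdGaussian_submodule_eq_zero) (by simpa using hrm))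
  filter_upwards [hind] with G hG
  have hrows := hG.map' (WithLp.linearEquiv 2 ℝ (Fin m → ℝ)).toLinearMap (LinearEquiv.ker _)
  have hrank := LinearIndependent.rank_matrix (M := Gᵀ) hrows
  rwa [Matrix.rank_transpose, Fintype.card_fin] at hrank

theorem stdNormalMatrix_slice_eq_prod
    {A : Set (Matrix (Fin m) (Fin r) ℝ × EuclideanSpace ℝ (Fin m))} (hA : MeasurableSet A)
    (hrot : ∀ Q : Matrix (Fin m) (Fin m) ℝ, Qᵀ * Q = 1 → ∀ G x,
      (Q * G, toEuclideanLin Q x) ∈ A ↔ (G, x) ∈ A)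
    (hscale : ∀ c : ℝ, 0 < c → ∀ G x, (G, c • x) ∈ A ↔ (G, x) ∈ A)
    {v : EuclideanSpace ℝ (Fin m)} (hv : v ≠ 0) :
    stdNormalMatrix m r {G | (G, v) ∈ A} = ((stdNormalMatrix m r).prod (stdGaussian _)) A := by
  have : Nontrivial (EuclideanSpace ℝ (Fin m)) := ⟨v, 0, hv⟩
  have hslice {x : EuclideanSpace ℝ (Fin m)} (hx : x ≠ 0) :
      stdNormalMatrix m r {G | (G, x) ∈ A} = stdNormalMatrix m r {G | (G, v) ∈ A} := by
    have hc : 0 < ‖v‖ / ‖x‖ := div_pos (norm_pos_iff.2 hv) (norm_pos_iff.2 hx)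
    obtain ⟨Q, hQ, hQx⟩ := exists_orthogonal_toEuclideanLin_eq (v := (‖v‖ / ‖x‖) • x) (w := v) (by
      rw [norm_smul, Real.norm_of_nonneg hc.le, div_mul_cancel₀ _ (norm_ne_zero_iff.2 hx)])
    have hslice_meas : MeasurableSet {G | (G, v) ∈ A} := hA.preimage measurable_prodMk_right
    rw [← (measurePreserving_mul_left hQ).measure_preimage hslice_meas.nullMeasurableSet]
    congr 1
    ext G
    rw [Set.mem_ofPred_eq, ← hscale _ hc, ← hrot Q hQ, hQx]
    rfl
  rw [Measure.prod_apply_symm hA]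
  calc _ = ∫⁻ _, stdNormalMatrix m r {G | (G, v) ∈ A} ∂(stdGaussian _) := by simp
    _ = _ := lintegral_congr_ae (ae_stdGaussian_ne_zero.mono fun x hx => (hslice hx).symm)

-- By rotation invariance a fixed vector may be replaced by an independent standard normal one.
theorem stdNormalMatrix_slice_le {A : Set (Matrix (Fin m) (Fin r) ℝ × EuclideanSpace ℝ (Fin m))}
    (hA : MeasurableSet A)
    (hrot : ∀ Q : Matrix (Fin m) (Fin m) ℝ, Qᵀ * Q = 1 → ∀ G x,
      (Q * G, toEuclideanLin Q x) ∈ A ↔ (G, x) ∈ A)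
    (hscale : ∀ c : ℝ, 0 < c → ∀ G x, (G, c • x) ∈ A ↔ (G, x) ∈ A) {ε : ℝ≥0∞}
    (hε : ∀ᵐ G ∂(stdNormalMatrix m r), stdGaussian _ {x | (G, x) ∈ A} ≤ ε)
    {v : EuclideanSpace ℝ (Fin m)} (hv : v ≠ 0) :
    stdNormalMatrix m r {G | (G, v) ∈ A} ≤ ε := by
  rw [stdNormalMatrix_slice_eq_prod hA hrot hscale hv, Measure.prod_apply hA]
  calc _ ≤ ∫⁻ _, ε ∂(stdNormalMatrix m r) := lintegral_mono_ae hε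
    _ = ε := by simp

end GaussianMatrices

section PolarFactor

variable {n m ρ : ℕ}

/-- The partial isometry `U Vᵀ` of a compact singular value decomposition `L = U Σ Vᵀ`, that is,
the isometric factor of the polar decomposition of `L`. It maps `ran Lᵀ` isometrically onto `ran L`
and vanishes on the orthogonal complement of `ran Lᵀ`. -/
noncomputable def polarFactor (L : Matrix (Fin n) (Fin m) ℝ) : Matrix (Fin n) (Fin m) ℝ :=
  svdLeft L * (svdRight L)ᵀ

theorem isSVD_svdLeft_svdRight (L : Matrix (Fin n) (Fin m) ℝ) :
    ∃ σ, IsSVD L (svdLeft L) σ (svdRight L) :=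
  ⟨_, (exists_isSVD L).choose_spec.choose_spec.choose_spec⟩

theorem rank_mul_diagonal_mul_transpose {U : Matrix (Fin n) (Fin ρ) ℝ} {σ : Fin ρ → ℝ}
    {V : Matrix (Fin m) (Fin ρ) ℝ} (hU : Uᵀ * U = 1) (hV : Vᵀ * V = 1) (hσ : ∀ i, 0 < σ i) :
    (U * diagonal σ * Vᵀ).rank = ρ := by
  refine le_antisymm ?_ ?_
  · rw [Matrix.mul_assoc]
    exact (rank_mul_le_left _ _).trans U.rank_le_width
  · have hdiag : Uᵀ * (U * diagonal σ * Vᵀ * V) = diagonal σ := by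
      rw [Matrix.mul_assoc _ Vᵀ, hV, Matrix.mul_one, ← Matrix.mul_assoc, hU, Matrix.one_mul]
    calc ρ = (diagonal σ).rank := by simp [rank_diagonal, (hσ _).ne']
      _ = (Uᵀ * (U * diagonal σ * Vᵀ * V)).rank := by rw [hdiag]
      _ ≤ (U * diagonal σ * Vᵀ * V).rank := rank_mul_le_right _ _
      _ ≤ _ := rank_mul_le_left _ _

theorem polarFactor_mul_diagonal_mul_transpose {U : Matrix (Fin n) (Fin ρ) ℝ} {σ : Fin ρ → ℝ}
    {V : Matrix (Fin m) (Fin ρ) ℝ} (hU : Uᵀ * U = 1) (hV : Vᵀ * V = 1) (hσ : ∀ i, 0 < σ i) :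
    polarFactor (U * diagonal σ * Vᵀ) = U * Vᵀ := by
  generalize hL : U * diagonal σ * Vᵀ = L
  obtain rfl : L.rank = ρ := hL ▸ rank_mul_diagonal_mul_transpose hU hV hσ
  obtain ⟨_, h⟩ := isSVD_svdLeft_svdRight L
  exact h.mul_transpose_unique ⟨hU, hV, hσ, hL.symm⟩

theorem polarFactor_transpose (L : Matrix (Fin n) (Fin m) ℝ) :
    polarFactor Lᵀ = (polarFactor L)ᵀ := by
  obtain ⟨σ, h⟩ := isSVD_svdLeft_svdRight L
  have hL := congrArg Matrix.transpose h.eq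
  rw [transpose_mul, transpose_mul, transpose_transpose, diagonal_transpose,
    ← Matrix.mul_assoc] at hL
  rw [hL, polarFactor_mul_diagonal_mul_transpose h.right_orthonormal h.left_orthonormal h.pos,
    polarFactor, transpose_mul, transpose_transpose]

theorem polarFactor_mul_transpose (L : Matrix (Fin n) (Fin m) ℝ) {Q : Matrix (Fin m) (Fin m) ℝ}
    (hQ : Qᵀ * Q = 1) : polarFactor (L * Qᵀ) = polarFactor L * Qᵀ := by
  obtain ⟨σ, h⟩ := isSVD_svdLeft_svdRight L
  have hL := congrArg (· * Qᵀ) h.eq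
  simp only [Matrix.mul_assoc _ (svdRight L)ᵀ, ← transpose_mul] at hL
  have hQV : (Q * svdRight L)ᵀ * (Q * svdRight L) = 1 := by
    rw [transpose_mul, Matrix.mul_assoc, ← Matrix.mul_assoc Qᵀ, hQ, Matrix.one_mul,
      h.right_orthonormal]
  rw [hL, polarFactor_mul_diagonal_mul_transpose h.left_orthonormal hQV h.pos, polarFactor,
    transpose_mul, Matrix.mul_assoc]

theorem ran_mul_le (A : Matrix (Fin n) (Fin ρ) ℝ) (B : Matrix (Fin ρ) (Fin m) ℝ) :
    ran (A * B) ≤ ran A := by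
  rw [ran, toLpLin_mul_same]
  exact LinearMap.range_comp_le_range _ _

theorem IsSVD.ran_transpose {L : Matrix (Fin n) (Fin m) ℝ} {U : Matrix (Fin n) (Fin L.rank) ℝ}
    {σ : Fin L.rank → ℝ} {V : Matrix (Fin m) (Fin L.rank) ℝ} (h : IsSVD L U σ V) :
    ran Lᵀ = ran V := by
  have hL : Lᵀ = V * (diagonal σ * Uᵀ) := by
    conv_lhs => rw [h.eq]
    simp only [transpose_mul, transpose_transpose, diagonal_transpose]
  have hV : V = Lᵀ * (U * diagonal fun i => (σ i)⁻¹) := by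
    rw [hL, Matrix.mul_assoc, Matrix.mul_assoc, ← Matrix.mul_assoc Uᵀ, h.left_orthonormal,
      Matrix.one_mul, diagonal_mul_diagonal]
    simp [(h.pos _).ne']
  refine le_antisymm ?_ ?_
  · rw [hL]; exact ran_mul_le _ _
  · conv_lhs => rw [hV]
    exact ran_mul_le _ _

theorem starProjection_ran_of_transpose_mul_self {V : Matrix (Fin m) (Fin ρ) ℝ} (hV : Vᵀ * V = 1)
    (x : EuclideanSpace ℝ (Fin m)) :
    (ran V).starProjection x = toEuclideanLin V (toEuclideanLin Vᵀ x) := by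
  have hmem : toEuclideanLin V (toEuclideanLin Vᵀ x) ∈ ran V := ⟨_, rfl⟩
  refine Submodule.eq_starProjection_of_mem_of_inner_eq_zero hmem ?_
  rintro _ ⟨y, rfl⟩
  have hVV (z : EuclideanSpace ℝ (Fin ρ)) : toEuclideanLin Vᵀ (toEuclideanLin V z) = z := by
    rw [← LinearMap.comp_apply, ← toLpLin_mul_same, hV, toLpLin_one, LinearMap.id_apply]
  rw [← LinearMap.adjoint_inner_left, ← toEuclideanLin_conjTranspose_eq_adjoint,
    conjTranspose_eq_transpose_of_trivial, map_sub, hVV, sub_self, inner_zero_left]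

theorem norm_toEuclideanLin_polarFactor (L : Matrix (Fin n) (Fin m) ℝ)
    (x : EuclideanSpace ℝ (Fin m)) :
    ‖toEuclideanLin (polarFactor L) x‖ = ‖(ran Lᵀ).starProjection x‖ := by
  obtain ⟨σ, h⟩ := isSVD_svdLeft_svdRight L
  rw [h.ran_transpose, starProjection_ran_of_transpose_mul_self h.right_orthonormal,
    norm_toEuclideanLin_of_transpose_mul_self h.right_orthonormal, polarFactor, toLpLin_mul_same,
    LinearMap.comp_apply, norm_toEuclideanLin_of_transpose_mul_self h.left_orthonormal]

open scoped MatrixOrder Matrix.Norms.L2Operator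

theorem IsSVD.sqrt_transpose_mul_self {L : Matrix (Fin n) (Fin m) ℝ}
    {U : Matrix (Fin n) (Fin L.rank) ℝ} {σ : Fin L.rank → ℝ} {V : Matrix (Fin m) (Fin L.rank) ℝ}
    (h : IsSVD L U σ V) : CFC.sqrt (Lᵀ * L) = V * diagonal σ * Vᵀ := by
  have hpos : (V * diagonal σ * Vᵀ).PosSemidef := by
    simpa using (PosSemidef.diagonal fun i => (h.pos i).le).mul_mul_conjTranspose_same V
  refine CFC.sqrt_unique ?_ hpos.nonneg
  have hL : Lᵀ * L = (U * diagonal σ * Vᵀ)ᵀ * (U * diagonal σ * Vᵀ) :=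
    congrArg (fun X => Xᵀ * X) h.eq
  have hV (X : Matrix (Fin L.rank) (Fin m) ℝ) : Vᵀ * (V * X) = X := by
    rw [← Matrix.mul_assoc, h.right_orthonormal, Matrix.one_mul]
  have hU (X : Matrix (Fin L.rank) (Fin m) ℝ) : Uᵀ * (U * X) = X := by
    rw [← Matrix.mul_assoc, h.left_orthonormal, Matrix.one_mul]
  rw [hL]
  simp only [transpose_mul, transpose_transpose, diagonal_transpose, Matrix.mul_assoc, hU, hV]

theorem posDef_sqrt_add_smul_one (A : Matrix (Fin m) (Fin m) ℝ) {ε : ℝ} (hε : 0 < ε) :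
    (CFC.sqrt A + ε • 1).PosDef :=
  PosDef.posSemidef_add (Matrix.nonneg_iff_posSemidef.1 (CFC.sqrt_nonneg A)) (PosDef.one.smul hε)

theorem IsSVD.mul_inv_sqrt_add_smul_one {L : Matrix (Fin n) (Fin m) ℝ}
    {U : Matrix (Fin n) (Fin L.rank) ℝ} {σ : Fin L.rank → ℝ} {V : Matrix (Fin m) (Fin L.rank) ℝ}
    (h : IsSVD L U σ V) {ε : ℝ} (hε : 0 < ε) :
    L * (CFC.sqrt (Lᵀ * L) + ε • 1)⁻¹ = U * diagonal (fun i => σ i / (σ i + ε)) * Vᵀ := by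
  have hunit := (isUnit_iff_isUnit_det _).1 (posDef_sqrt_add_smul_one (Lᵀ * L) hε).isUnit
  have hdiag : diagonal (fun i => σ i / (σ i + ε)) * (diagonal σ + ε • 1) = diagonal σ := by
    rw [smul_one_eq_diagonal, diagonal_add, diagonal_mul_diagonal]
    congr 1 with i
    exact div_mul_cancel₀ _ (add_pos (h.pos i) hε).ne'
  have hL : U * diagonal (fun i => σ i / (σ i + ε)) * Vᵀ * (CFC.sqrt (Lᵀ * L) + ε • 1) = L := by
    have hV : Vᵀ * (V * diagonal σ * Vᵀ + ε • 1) = (diagonal σ + ε • 1) * Vᵀ := by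
      rw [Matrix.mul_add, Matrix.add_mul, Matrix.mul_assoc V, ← Matrix.mul_assoc Vᵀ V,
        h.right_orthonormal, Matrix.one_mul, Matrix.mul_smul, Matrix.smul_mul, Matrix.mul_one,
        Matrix.one_mul]
    rw [h.sqrt_transpose_mul_self, Matrix.mul_assoc, hV, ← Matrix.mul_assoc, Matrix.mul_assoc U,
      hdiag, ← h.eq]
  rw [← mul_nonsing_inv_cancel_right _ (U * diagonal (fun i => σ i / (σ i + ε)) * Vᵀ) hunit, hL]

theorem tendsto_mul_inv_sqrt_add_smul_one (L : Matrix (Fin n) (Fin m) ℝ) :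
    Filter.Tendsto (fun ε : ℝ => L * (CFC.sqrt (Lᵀ * L) + ε • 1)⁻¹) (nhdsWithin 0 (Set.Ioi 0))
      (nhds (polarFactor L)) := by
  obtain ⟨σ, h⟩ := isSVD_svdLeft_svdRight L
  have hcont : ContinuousAt (fun ε : ℝ =>
      svdLeft L * diagonal (fun i => σ i / (σ i + ε)) * (svdRight L)ᵀ) 0 := by
    have hfrac : ContinuousAt (fun (ε : ℝ) i => σ i / (σ i + ε)) 0 :=
      continuousAt_pi.2 fun i => continuousAt_const.div (by fun_prop) (by simpa using (h.pos i).ne')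
    have hmul : Continuous fun d : Fin L.rank → ℝ =>
        svdLeft L * diagonal d * (svdRight L)ᵀ := by fun_prop
    exact hmul.continuousAt.comp hfrac
  have hlim := hcont.tendsto.mono_left (nhdsWithin_le_nhds (s := Set.Ioi 0))
  have hzero : (fun i => σ i / (σ i + 0)) = fun _ => 1 :=
    funext fun i => by rw [add_zero, div_self (h.pos i).ne']
  rw [hzero, diagonal_one, Matrix.mul_one] at hlim
  refine hlim.congr' ?_
  filter_upwards [self_mem_nhdsWithin] with ε hε
  exact (h.mul_inv_sqrt_add_smul_one hε).symm

theorem continuous_mul_inv_sqrt_add_smul_one {ε : ℝ} (hε : 0 < ε) :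
    Continuous fun L : Matrix (Fin n) (Fin m) ℝ => L * (CFC.sqrt (Lᵀ * L) + ε • 1)⁻¹ := by
  have hsqrt : Continuous fun L : Matrix (Fin n) (Fin m) ℝ => CFC.sqrt (Lᵀ * L) := by
    refine CFC.continuousOn_sqrt.comp_continuous (by fun_prop) fun L => ?_
    simpa [conjTranspose_eq_transpose_of_trivial] using
      (posSemidef_conjTranspose_mul_self L).nonneg
  refine continuous_id.matrix_mul (continuous_iff_continuousAt.2 fun L => ?_)
  simp only [nonsing_inv_eq_ringInverse]
  obtain ⟨u, hu⟩ := (posDef_sqrt_add_smul_one (Lᵀ * L) hε).isUnit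
  exact (hu ▸ NormedRing.inverse_continuousAt u).comp
    (f := fun L : Matrix (Fin n) (Fin m) ℝ => CFC.sqrt (Lᵀ * L) + ε • 1)
    (hsqrt.add continuous_const).continuousAt

theorem measurable_polarFactor :
    Measurable (polarFactor : Matrix (Fin n) (Fin m) ℝ → Matrix (Fin n) (Fin m) ℝ) := by
  have hseq : Filter.Tendsto (fun k : ℕ => 1 / ((k : ℝ) + 1)) Filter.atTop
      (nhdsWithin 0 (Set.Ioi 0)) :=
    tendsto_nhdsWithin_iff.2 ⟨tendsto_one_div_add_atTop_nhds_zero_nat,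
      Filter.Eventually.of_forall fun k => Set.mem_Ioi.2 Nat.one_div_pos_of_nat⟩
  exact measurable_of_tendsto_metrizable
    (fun k => (continuous_mul_inv_sqrt_add_smul_one Nat.one_div_pos_of_nat).measurable)
    (tendsto_pi_nhds.2 fun L => (tendsto_mul_inv_sqrt_add_smul_one L).comp hseq)

end PolarFactor

section LoadingsModel

variable {n r m : ℕ} {S : Matrix (Fin n) (Fin r) ℝ}

theorem permeance_mul_norm_sq_le (S : Matrix (Fin n) (Fin r) ℝ) (v : EuclideanSpace ℝ (Fin r)) :
    n * permeance S * ‖v‖ ^ 2 ≤ ‖toEuclideanLin S v‖ ^ 2 := by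
  rcases n.eq_zero_or_pos with rfl | hn
  · simp
  rcases eq_or_ne v 0 with rfl | hv
  · simp
  have hmem : ‖v‖⁻¹ • v ∈ Metric.sphere (0 : EuclideanSpace ℝ (Fin r)) 1 := by
    rw [mem_sphere_zero_iff_norm, norm_smul, norm_inv, norm_norm,
      inv_mul_cancel₀ (norm_ne_zero_iff.2 hv)]
  have hinf := ciInf_le (f := fun u : Metric.sphere (0 : EuclideanSpace ℝ (Fin r)) 1 =>
    ‖toEuclideanLin S u‖ ^ 2) ⟨0, by rintro _ ⟨u, rfl⟩; exact sq_nonneg _⟩ ⟨_, hmem⟩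
  simp only [map_smul, norm_smul, norm_inv, norm_norm, mul_pow, inv_pow] at hinf
  rw [← div_eq_inv_mul, le_div_iff₀ (by positivity)] at hinf
  rwa [permeance, ← mul_assoc, mul_one_div_cancel (by positivity), one_mul]

theorem pos_of_permeance_pos (hν : 0 < permeance S) : 0 < n ∧ 0 < r := by
  constructor <;> refine Nat.pos_of_ne_zero ?_ <;> rintro rfl
  · simp [permeance] at hν
  · have : IsEmpty (Metric.sphere (0 : EuclideanSpace ℝ (Fin 0)) 1) :=
      ⟨fun u => by simpa [Subsingleton.elim u.1 0] using mem_sphere_zero_iff_norm.1 u.2⟩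
    rw [permeance, Real.iInf_of_isEmpty, mul_zero] at hν
    exact hν.false

theorem mulVec_injective_of_permeance_pos (hν : 0 < permeance S) : Function.Injective S.mulVec := by
  refine (injective_iff_map_eq_zero S.mulVecLin).2 fun v hv => ?_
  have hn : (0 : ℝ) < n := Nat.cast_pos.2 (pos_of_permeance_pos hν).1
  have hle := permeance_mul_norm_sq_le S (WithLp.toLp 2 v)
  have hzero : toEuclideanLin S (WithLp.toLp 2 v) = 0 := congrArg (WithLp.toLp 2) hv
  rw [hzero, norm_zero, zero_pow two_ne_zero] at hle
  have hnorm : ‖WithLp.toLp 2 v‖ ^ 2 ≤ 0 := nonpos_of_mul_nonpos_right hle (by positivity)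
  simpa using (sq_nonpos_iff _).1 hnorm

theorem rank_mul_of_mulVec_injective {K l m n : Type*} [Field K] [Fintype m] [Fintype n]
    {A : Matrix l m K} (hA : Function.Injective A.mulVec) (B : Matrix m n K) :
    (A * B).rank = B.rank := by
  rw [rank, mulVecLin_mul, LinearMap.range_comp]
  exact (Submodule.equivMapOfInjective A.mulVecLin hA _).finrank_eq.symm

theorem rank_loadingsMatrix (hν : 0 < permeance S) (G : Matrix (Fin m) (Fin r) ℝ) :
    (loadingsMatrix S G).rank = G.rank := by
  have hr : (0 : ℝ) < r := Nat.cast_pos.2 (pos_of_permeance_pos hν).2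
  rw [loadingsMatrix, rank_smul_of_mem_nonZeroDivisors _
      (mem_nonZeroDivisors_of_ne_zero (by positivity)),
    rank_mul_of_mulVec_injective (mulVec_injective_of_permeance_pos hν), rank_transpose]

theorem measurableEmbedding_loadingsMatrix (hν : 0 < permeance S) :
    MeasurableEmbedding (loadingsMatrix (m := m) S) := by
  have hr : (0 : ℝ) < r := Nat.cast_pos.2 (pos_of_permeance_pos hν).2
  let f : Matrix (Fin m) (Fin r) ℝ →ₗ[ℝ] Matrix (Fin n) (Fin m) ℝ :=
    { toFun := loadingsMatrix S
      map_add' := fun G G' => by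
        simp only [loadingsMatrix, transpose_add, Matrix.mul_add, smul_add]
      map_smul' := fun c G => by
        simp only [loadingsMatrix, transpose_smul, Matrix.mul_smul, smul_comm c, RingHom.id_apply] }
  have hf : Function.Injective f := fun G G' h => by
    have hSG : S * Gᵀ = S * G'ᵀ := smul_right_injective _ (by positivity) h
    exact funext fun j => mulVec_injective_of_permeance_pos hν
      (congrArg (fun L : Matrix (Fin n) (Fin m) ℝ => L.col j) hSG)
  exact (LinearMap.isClosedEmbedding_of_injective (LinearMap.ker_eq_bot.2 hf)).measurableEmbedding

theorem GLM_apply (hν : 0 < permeance S) (s : Set (Matrix (Fin n) (Fin m) ℝ)) :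
    GLM S m s = stdNormalMatrix m r (loadingsMatrix S ⁻¹' s) :=
  (measurableEmbedding_loadingsMatrix hν).map_apply _ _

theorem ran_loadingsMatrix_le (S : Matrix (Fin n) (Fin r) ℝ) (G : Matrix (Fin m) (Fin r) ℝ) :
    ran (loadingsMatrix S G) ≤ ran S := by
  rw [loadingsMatrix, ← Matrix.mul_smul]
  exact ran_mul_le _ _

theorem norm_sq_starProjection_single_le (hν : 0 < permeance S) {k : Fin n}
    (hSk : ∑ j, S k j ^ 2 ≤ r) {K : Submodule ℝ (EuclideanSpace ℝ (Fin n))} (hK : K ≤ ran S) :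
    ‖K.starProjection (EuclideanSpace.single k (1 : ℝ))‖ ^ 2 ≤ r / (n * permeance S) := by
  have hn : (0 : ℝ) < n := Nat.cast_pos.2 (pos_of_permeance_pos hν).1
  set p := K.starProjection (EuclideanSpace.single k (1 : ℝ)) with hp
  have hpk : ‖p‖ ^ 2 = p k := by
    have hinner := K.starProjection_inner_eq_zero (EuclideanSpace.single k (1 : ℝ)) p
      (K.starProjection_apply_mem _)
    rw [← hp, inner_sub_left, sub_eq_zero, real_inner_self_eq_norm_sq,
      EuclideanSpace.inner_single_left] at hinner
    simpa using hinner.symm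
  obtain ⟨v, hv⟩ := hK (K.starProjection_apply_mem (EuclideanSpace.single k (1 : ℝ)))
  have hcauchy : p k ^ 2 ≤ r * ‖v‖ ^ 2 := by
    calc p k ^ 2 = (∑ j, S k j * v j) ^ 2 := by rw [hp, ← hv]; rfl
      _ ≤ (∑ j, S k j ^ 2) * ∑ j, v j ^ 2 := Finset.sum_mul_sq_le_sq_mul_sq _ _ _
      _ ≤ r * ‖v‖ ^ 2 := by rw [EuclideanSpace.real_norm_sq_eq]; gcongr
  have hperm : n * permeance S * ‖v‖ ^ 2 ≤ ‖p‖ ^ 2 := by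
    simpa only [hv] using permeance_mul_norm_sq_le S v
  rw [← hpk] at hcauchy
  have hsq : n * permeance S * ‖p‖ ^ 2 * ‖p‖ ^ 2 ≤ r * ‖p‖ ^ 2 := by
    calc _ = n * permeance S * (‖p‖ ^ 2) ^ 2 := by ring
      _ ≤ n * permeance S * (r * ‖v‖ ^ 2) := by gcongr
      _ = r * (n * permeance S * ‖v‖ ^ 2) := by ring
      _ ≤ r * ‖p‖ ^ 2 := by gcongr
  rw [le_div_iff₀ (by positivity), mul_comm]
  rcases (sq_nonneg ‖p‖).eq_or_lt with h | h
  · rw [← h, mul_zero]; positivity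
  · exact le_of_mul_le_mul_right hsq h

theorem leftIncoherence_le (hν : 0 < permeance S) (hS : ∀ k, ∑ j, S k j ^ 2 ≤ r)
    {L : Matrix (Fin n) (Fin m) ℝ} (hL : ran L ≤ ran S) (hrank : L.rank = r) :
    leftIncoherence L ≤ (permeance S)⁻¹ := by
  obtain ⟨hn, hr⟩ := pos_of_permeance_pos hν
  have : Nonempty (Fin n) := ⟨⟨0, hn⟩⟩
  calc leftIncoherence L ≤ n / r * (r / (n * permeance S)) := by
        rw [leftIncoherence, hrank]
        gcongr
        exact ciSup_le fun k => norm_sq_starProjection_single_le hν (hS k) hL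
    _ = (permeance S)⁻¹ := by field_simp

end LoadingsModel

section TailBounds

variable {n r m : ℕ} {S : Matrix (Fin n) (Fin r) ℝ}

theorem polarFactor_loadingsMatrix_mul (S : Matrix (Fin n) (Fin r) ℝ)
    (G : Matrix (Fin m) (Fin r) ℝ) {Q : Matrix (Fin m) (Fin m) ℝ} (hQ : Qᵀ * Q = 1) :
    polarFactor (loadingsMatrix S (Q * G)) = polarFactor (loadingsMatrix S G) * Qᵀ := by
  rw [← polarFactor_mul_transpose _ hQ]
  simp only [loadingsMatrix, transpose_mul, Matrix.smul_mul, Matrix.mul_assoc]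

theorem stdNormalMatrix_le_polarFactor_le (S : Matrix (Fin n) (Fin r) ℝ)
    {Φ : EuclideanSpace ℝ (Fin n) → ℝ} (hΦ : Measurable Φ)
    (hhom : ∀ (c : ℝ) y, Φ (c • y) = c ^ 2 * Φ y) {τ : ℝ} {ε : ℝ≥0∞}
    (hε : ∀ᵐ G ∂(stdNormalMatrix m r), stdGaussian (EuclideanSpace ℝ (Fin m))
      {x | τ * ‖x‖ ^ 2 ≤ Φ (toEuclideanLin (polarFactor (loadingsMatrix S G)) x)} ≤ ε)
    {v : EuclideanSpace ℝ (Fin m)} (hv : v ≠ 0) :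
    stdNormalMatrix m r
      {G | τ * ‖v‖ ^ 2 ≤ Φ (toEuclideanLin (polarFactor (loadingsMatrix S G)) v)} ≤ ε := by
  have happly : Continuous fun p : Matrix (Fin n) (Fin m) ℝ × EuclideanSpace ℝ (Fin m) =>
      toEuclideanLin p.1 p.2 := by
    simp only [toLpLin_apply]
    fun_prop
  have hL : Measurable fun p : Matrix (Fin m) (Fin r) ℝ × EuclideanSpace ℝ (Fin m) =>
      polarFactor (loadingsMatrix S p.1) :=
    measurable_polarFactor.comp ((measurable_loadingsMatrix S).comp measurable_fst)
  have hLx := happly.measurable.comp (hL.prodMk measurable_snd)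
  refine stdNormalMatrix_slice_le (A := {p : Matrix (Fin m) (Fin r) ℝ × EuclideanSpace ℝ (Fin m) |
    τ * ‖p.2‖ ^ 2 ≤ Φ (toEuclideanLin (polarFactor (loadingsMatrix S p.1)) p.2)})
    (measurableSet_le (by fun_prop) (hΦ.comp hLx)) (fun Q hQ G x => ?_) (fun c hc G x => ?_)
    hε hv
  · rw [Set.mem_ofPred_eq, Set.mem_ofPred_eq, norm_toEuclideanLin_of_transpose_mul_self hQ,
      polarFactor_loadingsMatrix_mul S G hQ, ← LinearMap.comp_apply, ← toLpLin_mul_same,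
      Matrix.mul_assoc, hQ, Matrix.mul_one]
  · rw [Set.mem_ofPred_eq, Set.mem_ofPred_eq, map_smul, hhom, norm_smul, mul_pow,
      Real.norm_of_nonneg hc.le, mul_left_comm, mul_le_mul_iff_right₀ (by positivity)]

theorem jointIncoherence_eq_ciSup_polarFactor (L : Matrix (Fin n) (Fin m) ℝ) :
    jointIncoherence L = n * m / L.rank * ⨆ kl : Fin n × Fin m, |polarFactor L kl.1 kl.2| ^ 2 :=
  rfl

theorem finrank_ran (L : Matrix (Fin n) (Fin m) ℝ) : Module.finrank ℝ (ran L) = L.rank :=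
  (rank_eq_finrank_range_toLin L (EuclideanSpace.basisFun _ ℝ).toBasis
    (EuclideanSpace.basisFun _ ℝ).toBasis).symm

theorem stdNormalMatrix_le_norm_sq_starProjection_le (hν : 0 < permeance S) (hrm : r ≤ m) (t : ℝ)
    {v : EuclideanSpace ℝ (Fin m)} (hv : v ≠ 0) :
    stdNormalMatrix m r
        {G | r * t / m * ‖v‖ ^ 2 ≤ ‖(ran (loadingsMatrix S G)ᵀ).starProjection v‖ ^ 2} ≤
      ENNReal.ofReal (4 * Real.exp (-t / 2)) := by
  simp only [← norm_toEuclideanLin_polarFactor]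
  refine stdNormalMatrix_le_polarFactor_le S (Φ := fun y => ‖y‖ ^ 2) (by fun_prop)
    (fun c y => by rw [norm_smul, mul_pow, Real.norm_eq_abs, sq_abs]) ?_ hv
  filter_upwards [ae_rank_stdNormalMatrix hrm] with G hG
  have hfinrank : Module.finrank ℝ (ran (loadingsMatrix S G)ᵀ) = r := by
    rw [finrank_ran, rank_transpose, rank_loadingsMatrix hν, hG]
  have hne : ran (loadingsMatrix S G)ᵀ ≠ ⊥ :=
    Submodule.one_le_finrank_iff.1 (hfinrank.symm ▸ (pos_of_permeance_pos hν).2)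
  have htail := stdGaussian_le_norm_sq_starProjection_le hne t
  simp only [norm_toEuclideanLin_polarFactor]
  rwa [hfinrank, finrank_euclideanSpace_fin] at htail

theorem stdNormalMatrix_le_polarFactor_apply_sq_le (hν : 0 < permeance S) {k : Fin n}
    (hSk : ∑ j, S k j ^ 2 ≤ r) (t : ℝ) {v : EuclideanSpace ℝ (Fin m)} (hv : v ≠ 0) :
    stdNormalMatrix m r {G | r / (n * permeance S) * (t / m) * ‖v‖ ^ 2 ≤
        (toEuclideanLin (polarFactor (loadingsMatrix S G)) v k) ^ 2} ≤
      ENNReal.ofReal (4 * Real.exp (-t / 2)) := by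
  obtain ⟨hn, hr⟩ := pos_of_permeance_pos hν
  have : Nontrivial (EuclideanSpace ℝ (Fin m)) := ⟨v, 0, hv⟩
  refine stdNormalMatrix_le_polarFactor_le S (Φ := fun y => y k ^ 2) (by fun_prop)
    (fun c y => by rw [PiLp.smul_apply, smul_eq_mul, mul_pow]) (.of_forall fun G => ?_) hv
  set L := loadingsMatrix S G
  have hrow : ‖toEuclideanLin (polarFactor Lᵀ) (EuclideanSpace.single k (1 : ℝ))‖ ^ 2 ≤
      r / (n * permeance S) := by
    rw [norm_toEuclideanLin_polarFactor, transpose_transpose]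
    exact norm_sq_starProjection_single_le hν hSk (ran_loadingsMatrix_le S G)
  have hinner (x : EuclideanSpace ℝ (Fin m)) :
      inner ℝ (toEuclideanLin (polarFactor Lᵀ) (EuclideanSpace.single k (1 : ℝ))) x =
        toEuclideanLin (polarFactor L) x k := by
    rw [polarFactor_transpose, ← conjTranspose_eq_transpose_of_trivial,
      toEuclideanLin_conjTranspose_eq_adjoint, LinearMap.adjoint_inner_left,
      EuclideanSpace.inner_single_left]
    simp
  have htail := stdGaussian_le_inner_sq_le (by positivity) hrow t
  simpa only [hinner, finrank_euclideanSpace_fin] using htail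

theorem measure_le_mul_ciSup_le {Ω ι : Type*} [MeasurableSpace Ω] [Fintype ι] [Nonempty ι]
    (μ : Measure Ω) {f : Ω → ι → ℝ} {a c : ℝ} (ha : 0 < a) {ε : ℝ≥0∞}
    (hε : ∀ i, μ {ω | c / a ≤ f ω i} ≤ ε) :
    μ {ω | c ≤ a * ⨆ i, f ω i} ≤ Fintype.card ι * ε := by
  calc μ {ω | c ≤ a * ⨆ i, f ω i} ≤ μ (⋃ i, {ω | c / a ≤ f ω i}) := by
        refine measure_mono fun ω hω => ?_
        obtain ⟨i, hi⟩ := exists_eq_ciSup_of_finite (f := f ω)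
        rw [Set.mem_ofPred_eq, ← hi, ← div_le_iff₀' ha] at hω
        exact Set.mem_iUnion.2 ⟨i, hω⟩
    _ ≤ ∑ i, μ {ω | c / a ≤ f ω i} := measure_iUnion_fintype_le _ _
    _ ≤ ∑ _i : ι, ε := Finset.sum_le_sum fun i _ => hε i
    _ = Fintype.card ι * ε := by rw [Finset.sum_const, Finset.card_univ, nsmul_eq_mul]

theorem stdNormalMatrix_le_rightIncoherence_le (hν : 0 < permeance S) (hrm : r ≤ m) (t : ℝ) :
    stdNormalMatrix m r {G | t ≤ rightIncoherence (loadingsMatrix S G)} ≤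
      m * ENNReal.ofReal (4 * Real.exp (-t / 2)) := by
  have hr := (pos_of_permeance_pos hν).2
  have hm := hr.trans_le hrm
  have : Nonempty (Fin m) := ⟨⟨0, hm⟩⟩
  calc _ ≤ stdNormalMatrix m r {G | t ≤ (m / r : ℝ) * ⨆ l,
        ‖(ran (loadingsMatrix S G)ᵀ).starProjection (EuclideanSpace.single l (1 : ℝ))‖ ^ 2} := by
        refine measure_mono_ae ?_
        filter_upwards [ae_rank_stdNormalMatrix hrm] with G hG (ht : t ≤ rightIncoherence _)
        rw [rightIncoherence, rank_loadingsMatrix hν, hG] at ht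
        exact ht
    _ ≤ Fintype.card (Fin m) * ENNReal.ofReal (4 * Real.exp (-t / 2)) := by
        refine measure_le_mul_ciSup_le _ (by positivity) fun l => ?_
        have hcol := stdNormalMatrix_le_norm_sq_starProjection_le hν hrm t
          (v := EuclideanSpace.single l (1 : ℝ)) (by simp)
        rwa [PiLp.norm_single, norm_one, one_pow, mul_one, mul_comm (r : ℝ),
          ← div_div_eq_mul_div] at hcol
    _ = _ := by rw [Fintype.card_fin]

theorem stdNormalMatrix_le_jointIncoherence_le (hν : 0 < permeance S)
    (hS : ∀ k, ∑ j, S k j ^ 2 ≤ r) (hrm : r ≤ m) (t : ℝ) :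
    stdNormalMatrix m r {G | t / permeance S ≤ jointIncoherence (loadingsMatrix S G)} ≤
      n * m * ENNReal.ofReal (4 * Real.exp (-t / 2)) := by
  obtain ⟨hn, hr⟩ := pos_of_permeance_pos hν
  have hm := hr.trans_le hrm
  have : Nonempty (Fin n × Fin m) := ⟨⟨0, hn⟩, ⟨0, hm⟩⟩
  calc _ ≤ stdNormalMatrix m r {G | t / permeance S ≤ (n * m / r : ℝ) *
        ⨆ kl : Fin n × Fin m, |polarFactor (loadingsMatrix S G) kl.1 kl.2| ^ 2} := by
        refine measure_mono_ae ?_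
        filter_upwards [ae_rank_stdNormalMatrix hrm] with G hG
          (ht : t / permeance S ≤ jointIncoherence _)
        rw [jointIncoherence_eq_ciSup_polarFactor, rank_loadingsMatrix hν, hG] at ht
        exact ht
    _ ≤ Fintype.card (Fin n × Fin m) * ENNReal.ofReal (4 * Real.exp (-t / 2)) := by
        refine measure_le_mul_ciSup_le _ (by positivity) fun kl => ?_
        have hentry := stdNormalMatrix_le_polarFactor_apply_sq_le hν (hS kl.1) t
          (v := EuclideanSpace.single kl.2 (1 : ℝ)) (by simp)
        have hthreshold : t / permeance S / (n * m / r) = r / (n * permeance S) * (t / m) := by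
          field_simp
        simpa [hthreshold, toLpLin_apply] using hentry
    _ = _ := by simp

end TailBounds

theorem four_mul_exp_neg_log_add_le {x y α : ℝ} (hx : 0 < x) (hy : 0 < y) (hα : -1 / 2 ≤ α) :
    4 * Real.exp (-(4 * (α + 1) * Real.log (x + y)) / 2) ≤ 2 * ((x * y) ^ (-α) / (x * y)) := by
  calc 4 * Real.exp (-(4 * (α + 1) * Real.log (x + y)) / 2)
      = 4 * ((x + y) ^ 2) ^ (-(α + 1)) := by
        rw [← Real.rpow_natCast, ← Real.rpow_mul (by positivity),
          Real.rpow_def_of_pos (by positivity)]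
        congr 2
        push_cast
        ring
    _ ≤ 4 * (4 * (x * y)) ^ (-(α + 1)) := by
        gcongr 4 * ?_
        exact Real.rpow_le_rpow_of_nonpos (by positivity) (by nlinarith [sq_nonneg (x - y)])
          (by linarith)
    _ = 4 ^ (-α) * ((x * y) ^ (-α) / (x * y)) := by
        rw [Real.mul_rpow (by positivity) (by positivity), neg_add, Real.rpow_add (by positivity),
          Real.rpow_add (by positivity), Real.rpow_neg_one, Real.rpow_neg_one]
        field_simp
    _ ≤ 2 * ((x * y) ^ (-α) / (x * y)) := by
        gcongr
        calc (4 : ℝ) ^ (-α) ≤ 4 ^ (1 / 2 : ℝ) :=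
              Real.rpow_le_rpow_of_exponent_le (by norm_num) (by linarith)
          _ = 2 := by rw [← Real.sqrt_eq_rpow, show (4 : ℝ) = 2 ^ 2 by norm_num]; simp

theorem IsSignMatrix.sum_sq {n r : ℕ} {S : Matrix (Fin n) (Fin r) ℝ} (hS : IsSignMatrix S)
    (k : Fin n) : ∑ j, S k j ^ 2 = r := by
  have hsq (j : Fin r) : S k j ^ 2 = 1 := sq_eq_one_iff.2 (hS k j)
  simp [hsq]

section GaussianLoadingsModel

variable {n r m : ℕ} {S : Matrix (Fin n) (Fin r) ℝ}

theorem ae_GLM_rank_eq_and_leftIncoherence_le (hν : 0 < permeance S)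
    (hS : ∀ k, ∑ j, S k j ^ 2 ≤ r) (hrm : r ≤ m) :
    ∀ᵐ L ∂GLM S m, L.rank = r ∧ leftIncoherence L ≤ (permeance S)⁻¹ := by
  rw [GLM, (measurableEmbedding_loadingsMatrix hν).ae_map_iff]
  filter_upwards [ae_rank_stdNormalMatrix hrm] with G hG
  have hrank := (rank_loadingsMatrix hν G).trans hG
  exact ⟨hrank, leftIncoherence_le hν hS (ran_loadingsMatrix_le S G) hrank⟩

theorem GLM_le_rightIncoherence_le (hν : 0 < permeance S) (hrm : r ≤ m) {α : ℝ}
    (hα : -1 / 2 ≤ α) :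
    GLM S m {L | 4 * (α + 1) * Real.log ((n : ℝ) + m) ≤ rightIncoherence L} ≤
      ENNReal.ofReal (2 * ((n : ℝ) * m) ^ (-α) / n) := by
  obtain ⟨hn, hr⟩ := pos_of_permeance_pos hν
  have hm := hr.trans_le hrm
  rw [GLM_apply hν]
  refine (stdNormalMatrix_le_rightIncoherence_le hν hrm _).trans ?_
  rw [← ENNReal.ofReal_natCast, ← ENNReal.ofReal_mul (by positivity)]
  refine ENNReal.ofReal_le_ofReal ?_
  calc _ ≤ m * (2 * (((n : ℝ) * m) ^ (-α) / (n * m))) := by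
        refine mul_le_mul_of_nonneg_left (four_mul_exp_neg_log_add_le ?_ ?_ hα) ?_ <;> positivity
    _ = 2 * ((n : ℝ) * m) ^ (-α) / n := by field_simp

theorem GLM_le_jointIncoherence_le (hν : 0 < permeance S) (hS : ∀ k, ∑ j, S k j ^ 2 ≤ r)
    (hrm : r ≤ m) {α : ℝ} (hα : -1 / 2 ≤ α) :
    GLM S m {L | 4 * (α + 1) / permeance S * Real.log ((n : ℝ) + m) ≤ jointIncoherence L} ≤
      ENNReal.ofReal (2 * ((n : ℝ) * m) ^ (-α)) := by
  obtain ⟨hn, hr⟩ := pos_of_permeance_pos hν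
  have hm := hr.trans_le hrm
  rw [GLM_apply hν, div_mul_eq_mul_div]
  refine (stdNormalMatrix_le_jointIncoherence_le hν hS hrm _).trans ?_
  rw [← ENNReal.ofReal_natCast n, ← ENNReal.ofReal_natCast m,
    ← ENNReal.ofReal_mul (by positivity), ← ENNReal.ofReal_mul (by positivity)]
  refine ENNReal.ofReal_le_ofReal ?_
  calc _ ≤ (n * m : ℝ) * (2 * (((n : ℝ) * m) ^ (-α) / (n * m))) := by
        refine mul_le_mul_of_nonneg_left (four_mul_exp_neg_log_add_le ?_ ?_ hα) ?_ <;> positivity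
    _ = 2 * ((n : ℝ) * m) ^ (-α) := by field_simp

end GaussianLoadingsModel

end GaussianLoadings

theorem mainTheorem8_general {n r m : ℕ} (S : Matrix (Fin n) (Fin r) ℝ)
    (hS : ∀ k, ∑ j, S k j ^ 2 ≤ r) (hν : 0 < permeance S) (hm : r ≤ m)
    {Ω : Type*} [MeasurableSpace Ω] (P : Measure Ω)
    (L₀ : Ω → Matrix (Fin n) (Fin m) ℝ) (hL₀ : HasLaw L₀ (GLM S m) P) :
    (∀ G : Matrix (Fin m) (Fin r) ℝ, G.rank = r →
      leftIncoherence (loadingsMatrix S G) ≤ (permeance S)⁻¹) ∧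
    (∀ᵐ ω ∂P, (L₀ ω).rank = r ∧ leftIncoherence (L₀ ω) ≤ (permeance S)⁻¹) ∧
    ∀ α : ℝ, -1 / 2 ≤ α →
      P {ω | rightIncoherence (L₀ ω) ≥ 4 * (α + 1) * Real.log ((n : ℝ) + m)} ≤
          ENNReal.ofReal (2 * ((n : ℝ) * m) ^ (-α) / n) ∧
      P {ω | jointIncoherence (L₀ ω) ≥
            4 * (α + 1) / permeance S * Real.log ((n : ℝ) + m)} ≤
          ENNReal.ofReal (2 * ((n : ℝ) * m) ^ (-α)) := by
  have hpreimage (s : Set (Matrix (Fin n) (Fin m) ℝ)) : P (L₀ ⁻¹' s) ≤ GLM S m s :=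
    hL₀.map_eq ▸ Measure.le_map_apply hL₀.aemeasurable s
  refine ⟨fun G hG => ?_, ?_, fun α hα => ⟨?_, ?_⟩⟩
  · exact leftIncoherence_le hν hS (ran_loadingsMatrix_le S G) ((rank_loadingsMatrix hν G).trans hG)
  · have hGLM := ae_GLM_rank_eq_and_leftIncoherence_le hν hS hm
    rw [← hL₀.map_eq] at hGLM
    exact ae_of_ae_map hL₀.aemeasurable hGLM
  · exact (hpreimage _).trans (GLM_le_rightIncoherence_le hν hm hα)
  · exact (hpreimage _).trans (GLM_le_jointIncoherence_le hν hS hm hα)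

theorem mainTheorem8 {n r m : ℕ} (S : Matrix (Fin n) (Fin r) ℝ) (hS : IsSignMatrix S)
    (hν : 0 < permeance S) (hm : r ≤ m)
    {Ω : Type*} [MeasurableSpace Ω] (P : Measure Ω) [IsProbabilityMeasure P]
    (L₀ : Ω → Matrix (Fin n) (Fin m) ℝ) (hL₀ : HasLaw L₀ (GLM S m) P) :
    (∀ G : Matrix (Fin m) (Fin r) ℝ, G.rank = r →
      leftIncoherence (loadingsMatrix S G) ≤ (permeance S)⁻¹) ∧
    (∀ᵐ ω ∂P, (L₀ ω).rank = r ∧ leftIncoherence (L₀ ω) ≤ (permeance S)⁻¹) ∧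
    ∀ α : ℝ, 0 < α →
      P {ω | rightIncoherence (L₀ ω) ≥ 4 * (α + 1) * Real.log ((n : ℝ) + m)} ≤
          ENNReal.ofReal (2 * ((n : ℝ) * m) ^ (-α) / n) ∧
      P {ω | jointIncoherence (L₀ ω) ≥
            4 * (α + 1) / permeance S * Real.log ((n : ℝ) + m)} ≤
          ENNReal.ofReal (2 * ((n : ℝ) * m) ^ (-α)) :=
  have h := mainTheorem8_general S (fun k => (hS.sum_sq k).le) hν hm P L₀ hL₀
  ⟨h.1, h.2.1, fun α hα => h.2.2 α (by linarith)⟩
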